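/- Let $A=\bigoplus_{i\ge 0}A_i$ be an $\mathbb{N}$-graded ring which is left finite (every $A_i$ is a finitely generated left $A_0$-module) and generated in degree $1$ ($A_iA_j=A_{i+j}$ for all $i,j\ge 0$), and suppose that $A_0$ is left noetherian and semiperfect ($A_0/J(A_0)$ is artinian semisimple and idempotents lift modulo the Jacobson radical $J(A_0)$). Let $J=J(A_0)\oplus\bigoplus_{i\ge 1}A_i$ be the graded Jacobson radical of $A$ and let $S=A/J$. For $\mathbb{Z}$-graded left $A$-modules $X,Y$ put $\underline{\mathrm{Ext}}^n_A(X,Y)=\bigoplus_{l\in\mathbb{Z}}\mathrm{Ext}^n_{\mathrm{Gr}A}(X,Y(l))$, where $\mathrm{Gr}A$ is the category of graded left $A$-modules and degree-preserving $A$-linear maps and $Y(l)_k=Y_{k+l}$; a dot denotes the Yoneda product, and the product of two groups of extensions is the subgroup generated by the products of their elements. A graded projective resolution $\cdots\to P_1\xrightarrow{d_1}P_0\xrightarrow{d_0}M\to 0$ is minimal if $\operatorname{Im} d_{n+1}\subseteq JP_n$ for all $n\ge 0$. A graded module $M$ is called quasi-Koszul if it has a minimal graded projective resolution and $J\operatorname{Ker}d_n=\operatorname{Ker}d_n\cap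 J^2P_n$ for all $n\ge 0$ in its minimal graded projective resolution; $A$ is called a quasi-Koszul ring if the graded $A$-module $S$ is quasi-Koszul. (1) Let $M$ be a graded left $A$-module which is left finite (every $M_k$ is a finitely generated $A_0$-module) and bounded below ($M_k=0$ for all sufficiently small $k$). Then $M$ is quasi-Koszul if and only if, for all $n>0$, $$\underline{\mathrm{Ext}}^1_A(S,S)\cdot\underline{\mathrm{Ext}}^{n-1}_A(M,S)=\underline{\mathrm{Ext}}^n_A(M,S).$$ (2) $A$ is a quasi-Koszul ring if and only if the Yoneda Ext ring $E(A)=\bigoplus_{n\ge 0}\underline{\mathrm{Ext}}^n_A(S,S)$ is generated by $\underline{\mathrm{Ext}}^1_A(S,S)$ over $\underline{\mathrm{Hom}}_A(S,S)$, and also if and only if $E(A)$ is generated in degree $1$, that is, $\underline{\mathrm{Ext}}^j_A(S,S)\cdot\underline{\mathrm{Ext}}^i_A(S,S)=\underline{\mathrm{Ext}}^{i+j}_A(S,S)$ for all $i,j\ge 0$. -/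

import Mathlib

universe u

open CategoryTheory CategoryTheory.Limits DirectSum

/-! ### Rings -/

/-- A ring `R` is semiperfect if `R / J(R)` is artinian semisimple and idempotents lift modulo the
Jacobson radical `J(R)`. -/
def IsSemiperfectRing (R : Type*) [Ring R] : Prop :=
  IsSemisimpleRing (R ⧸ Ring.jacobson R) ∧
    ∀ x : R, x * x - x ∈ Ring.jacobson R →
      ∃ e : R, IsIdempotentElem e ∧ e - x ∈ Ring.jacobson R

section Ring

variable {A : Type u} [Ring A] (𝒜 : ℕ → AddSubgroup A) [GradedRing 𝒜]

/-- The additive subgroup `N` of the `A`-module `M` is a finitely generated `A₀`-submodule. -/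
def IsFGOverDegreeZero {M : Type u} [AddCommGroup M] [Module A M] (N : AddSubgroup M) : Prop :=
  ∃ s : Finset M, (Submodule.span (SetLike.GradeZero.subring 𝒜) (s : Set M)).toAddSubgroup = N

/-- `A` is left finite: every `Aₙ` is a finitely generated left `A₀`-module. -/
def IsLeftFiniteRing : Prop := ∀ n, IsFGOverDegreeZero 𝒜 (𝒜 n)

/-- `A` is generated in degree `1`: `Aᵢ Aⱼ = Aᵢ₊ⱼ` for all `i, j ≥ 0`. -/
def IsGeneratedInDegreeOne : Prop :=
  ∀ i j : ℕ, AddSubgroup.closure {x : A | ∃ a ∈ 𝒜 i, ∃ b ∈ 𝒜 j, x = a * b} = 𝒜 (i + j)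

/-- The graded Jacobson radical `J = J(A₀) ⊕ A_{≥ 1}`, that is, the set of all elements whose
component of degree `0` lies in `J(A₀)`. -/
noncomputable def gradedRadical : Ideal A :=
  (Ring.jacobson (𝒜 0)).comap (GradedRing.projZeroRingHom' 𝒜)

/-- The `ℕ`-grading of `A` seen as a `ℤ`-grading: `Aₖ = 0` for `k < 0`. -/
def intGrading : ℤ → AddSubgroup A
  | Int.ofNat n => 𝒜 n
  | Int.negSucc _ => ⊥

end Ring

/-! ### Internal gradings by `ℤ` -/

section Internal

variable {M : Type*} [AddCommGroup M] {G : ℤ → AddSubgroup M}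

theorem isInternal_of_proj (p : ℤ → M →+ M) (h1 : ∀ k, ∀ m ∈ G k, p k m = m)
    (h0 : ∀ k l, k ≠ l → ∀ m ∈ G l, p k m = 0) (ht : ∀ m, m ∈ ⨆ k, G k) :
    DirectSum.IsInternal G := by
  have key : ∀ (k : ℤ) (x : ⨁ k, G k), p k (DirectSum.coeAddMonoidHom G x) = (x k : M) := by
    intro k x
    induction x using DirectSum.induction_on with
    | zero => simp
    | of l y =>
      rw [DirectSum.coeAddMonoidHom_of]
      by_cases h : k = l
      · subst h; rw [h1 _ _ y.2, DirectSum.of_eq_same]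
      · rw [h0 _ _ h _ y.2, DirectSum.of_eq_of_ne _ _ _ h]; rfl
    | add x y hx hy => rw [map_add, map_add, hx, hy]; rfl
  constructor
  · rw [injective_iff_map_eq_zero]
    intro x hx
    ext k
    rw [← key k x, hx, map_zero]; rfl
  · intro m
    have : (⨆ k, G k) ≤ (DirectSum.coeAddMonoidHom G).range :=
      iSup_le fun k y hy => ⟨DirectSum.of (fun k => G k) k ⟨y, hy⟩, by simp⟩
    exact this (ht m)

/-- The projection onto the component of degree `k` of an internal grading. -/
noncomputable def internalProj (h : DirectSum.IsInternal G) (k : ℤ) : M →+ M :=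
  ((G k).subtype.comp (DFinsupp.evalAddMonoidHom k : (⨁ k, G k) →+ G k)).comp
    (AddEquiv.ofBijective (DirectSum.coeAddMonoidHom G) h).symm.toAddMonoidHom

theorem internalProj_coe (h : DirectSum.IsInternal G) (k : ℤ) (x : ⨁ k, G k) :
    internalProj h k (DirectSum.coeAddMonoidHom G x) = (x k : M) := by
  have : (AddEquiv.ofBijective (DirectSum.coeAddMonoidHom G) h).symm
      (DirectSum.coeAddMonoidHom G x) = x := by
    rw [AddEquiv.symm_apply_eq]; rfl
  simp only [internalProj, AddMonoidHom.comp_apply, AddEquiv.coe_toAddMonoidHom, this]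
  rfl

theorem internalProj_mem (h : DirectSum.IsInternal G) (k : ℤ) (m : M) :
    internalProj h k m ∈ G k := by
  obtain ⟨x, rfl⟩ := h.2 m
  rw [internalProj_coe]; exact (x k).2

theorem internalProj_same (h : DirectSum.IsInternal G) (k : ℤ) (m : M) (hm : m ∈ G k) :
    internalProj h k m = m := by
  have := internalProj_coe h k (DirectSum.of (fun k => G k) k ⟨m, hm⟩)
  simpa using this

theorem internalProj_ne (h : DirectSum.IsInternal G) (k l : ℤ) (hkl : k ≠ l) (m : M)
    (hm : m ∈ G l) : internalProj h k m = 0 := by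
  have := internalProj_coe h k (DirectSum.of (fun k => G k) l ⟨m, hm⟩)
  rw [DirectSum.of_eq_of_ne _ _ _ hkl] at this
  simpa using this

theorem mem_iSup_of_internal (h : DirectSum.IsInternal G) (m : M) : m ∈ ⨆ k, G k := by
  obtain ⟨x, rfl⟩ := h.2 m
  induction x using DirectSum.induction_on with
  | zero => simp
  | of l y =>
    rw [DirectSum.coeAddMonoidHom_of]
    exact (le_iSup G l) y.2
  | add x y hx hy => rw [map_add]; exact add_mem hx hy

/-- A statement stable under sums holds for all elements if it holds for homogeneous ones. -/
theorem internal_induction (h : DirectSum.IsInternal G) {p : M → Prop}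
    (hom : ∀ k, ∀ m ∈ G k, p m) (zero : p 0) (add : ∀ x y, p x → p y → p (x + y)) (m : M) :
    p m :=
  AddSubgroup.iSup_induction G (C := p) (mem_iSup_of_internal h m) hom zero add

/-- Every element is the sum of its components. -/
theorem exists_sum_internalProj (h : DirectSum.IsInternal G) (m : M) :
    ∃ s : Finset ℤ, ∑ k ∈ s, internalProj h k m = m := by
  classical
  obtain ⟨x, rfl⟩ := h.2 m
  refine ⟨DFinsupp.support x, ?_⟩
  simp_rw [internalProj_coe]
  exact (DirectSum.coeAddMonoidHom_eq_dfinsuppSum _ x).symm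

end Internal

/-! ### Graded modules -/

/-- A (left, `ℤ`-)graded `A`-module: an `A`-module `M` with a direct sum decomposition
`M = ⨁ₖ Mₖ` such that `Aᵢ Mₖ ⊆ Mᵢ₊ₖ`. -/
structure GrMod {A : Type u} [Ring A] (𝒜 : ℕ → AddSubgroup A) where
  carrier : Type u
  [addCommGroup : AddCommGroup carrier]
  [module : Module A carrier]
  grading : ℤ → AddSubgroup carrier
  isInternal : DirectSum.IsInternal grading
  smul_mem : ∀ (i : ℕ) (k : ℤ) (a : A) (m : carrier),
    a ∈ 𝒜 i → m ∈ grading k → a • m ∈ grading (i + k)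

namespace GrMod

variable {A : Type u} [Ring A] {𝒜 : ℕ → AddSubgroup A}

attribute [instance] GrMod.addCommGroup GrMod.module

instance : CoeSort (GrMod 𝒜) (Type u) := ⟨GrMod.carrier⟩

/-- A morphism of graded modules: an `A`-linear map that preserves degrees. -/
@[ext]
structure Hom (M N : GrMod 𝒜) where
  toLin : M →ₗ[A] N
  map_mem : ∀ k, ∀ m ∈ M.grading k, toLin m ∈ N.grading k

instance : Category (GrMod 𝒜) where
  Hom := Hom
  id M := ⟨LinearMap.id, fun _ _ h => h⟩
  comp f g := ⟨g.toLin ∘ₗ f.toLin, fun k m h => g.map_mem k _ (f.map_mem k m h)⟩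

/-- The linear map underlying a morphism. -/
def lin {M N : GrMod 𝒜} (f : M ⟶ N) : M →ₗ[A] N := Hom.toLin f

/-- Constructor of morphisms. -/
def ofLin {M N : GrMod 𝒜} (f : M →ₗ[A] N) (h : ∀ k, ∀ m ∈ M.grading k, f m ∈ N.grading k) :
    M ⟶ N := Hom.mk f h

theorem lin_mem {M N : GrMod 𝒜} (f : M ⟶ N) (k : ℤ) (m : M) (h : m ∈ M.grading k) :
    lin f m ∈ N.grading k := Hom.map_mem f k m h

@[simp] theorem lin_ofLin {M N : GrMod 𝒜} (f : M →ₗ[A] N)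
    (h : ∀ k, ∀ m ∈ M.grading k, f m ∈ N.grading k) : lin (ofLin f h) = f := rfl

@[simp] theorem lin_id (M : GrMod 𝒜) : lin (𝟙 M) = LinearMap.id := rfl

@[simp] theorem lin_comp {M N L : GrMod 𝒜} (f : M ⟶ N) (g : N ⟶ L) :
    lin (f ≫ g) = lin g ∘ₗ lin f := rfl

theorem hom_ext {M N : GrMod 𝒜} {f g : M ⟶ N} (h : ∀ m, lin f m = lin g m) : f = g :=
  Hom.ext (LinearMap.ext h)

section Preadditive

variable {M N : GrMod 𝒜}

instance : Add (M ⟶ N) :=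
  ⟨fun f g => ofLin (lin f + lin g) fun k m h => add_mem (lin_mem f k m h) (lin_mem g k m h)⟩

instance : Zero (M ⟶ N) := ⟨ofLin 0 fun k _ _ => zero_mem (N.grading k)⟩

instance : Neg (M ⟶ N) := ⟨fun f => ofLin (-lin f) fun k m h => neg_mem (lin_mem f k m h)⟩

@[simp] theorem lin_add (f g : M ⟶ N) : lin (f + g) = lin f + lin g := rfl
@[simp] theorem lin_zero : lin (0 : M ⟶ N) = 0 := rfl
@[simp] theorem lin_neg (f : M ⟶ N) : lin (-f) = -lin f := rfl

instance : AddCommGroup (M ⟶ N) where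
  add_assoc _ _ _ := hom_ext fun _ => by simp [add_assoc]
  zero_add _ := hom_ext fun _ => by simp
  add_zero _ := hom_ext fun _ => by simp
  neg_add_cancel _ := hom_ext fun _ => by simp
  add_comm _ _ := hom_ext fun _ => by simp [add_comm]
  nsmul := nsmulRec
  zsmul := zsmulRec

end Preadditive

instance : Preadditive (GrMod 𝒜) where
  add_comp _ _ _ _ _ _ := hom_ext fun _ => by simp
  comp_add _ _ _ _ _ _ := hom_ext fun _ => by simp

/-- The projection of `M` onto its component of degree `k`. -/
noncomputable def proj (M : GrMod 𝒜) (k : ℤ) : M →+ M := internalProj M.isInternal k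

theorem lin_proj {M N : GrMod 𝒜} (f : M ⟶ N) (k : ℤ) (m : M) :
    lin f (M.proj k m) = N.proj k (lin f m) := by
  refine internal_induction M.isInternal
    (p := fun m => lin f (M.proj k m) = N.proj k (lin f m)) ?_ ?_ ?_ m
  · intro l m hm
    by_cases h : k = l
    · subst h
      rw [proj, proj, internalProj_same _ _ _ hm, internalProj_same _ _ _ (lin_mem f _ _ hm)]
    · rw [proj, proj, internalProj_ne _ _ _ h _ hm, internalProj_ne _ _ _ h _ (lin_mem f _ _ hm),
        map_zero]
  · simp
  · intro x y hx hy
    simp [hx, hy]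

/-- The graded submodule given by a homogeneous submodule. -/
def sub (M : GrMod 𝒜) (N : Submodule A M) (hN : ∀ k, ∀ m ∈ N, M.proj k m ∈ N) : GrMod 𝒜 where
  carrier := N
  grading k := (M.grading k).comap N.subtype.toAddMonoidHom
  isInternal := by
    refine isInternal_of_proj
      (fun k => ((M.proj k).comp N.subtype.toAddMonoidHom).codRestrict N.toAddSubgroup
        fun m => hN k m m.2) ?_ ?_ ?_
    · intro k m hm
      exact Subtype.ext (internalProj_same M.isInternal k m hm)
    · intro k l hkl m hm
      exact Subtype.ext (internalProj_ne M.isInternal k l hkl m hm)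
    · intro m
      obtain ⟨s, hs⟩ := exists_sum_internalProj M.isInternal (m : M)
      have : m = ∑ k ∈ s, (⟨M.proj k m, hN k m m.2⟩ : N) := by
        apply Subtype.ext
        rw [AddSubmonoidClass.coe_finsetSum]
        exact hs.symm
      rw [this]
      refine sum_mem fun k _ => AddSubgroup.mem_iSup_of_mem k ?_
      exact internalProj_mem M.isInternal k m
  smul_mem i k a m ha hm := M.smul_mem i k a m ha hm

/-- The graded quotient module by a homogeneous submodule; its component of degree `k` is the
image of `Mₖ`. -/
def quot (M : GrMod 𝒜) (N : Submodule A M) (hN : ∀ k, ∀ m ∈ N, M.proj k m ∈ N) : GrMod 𝒜 where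
  carrier := M ⧸ N
  grading k := (M.grading k).map N.mkQ.toAddMonoidHom
  isInternal := by
    refine isInternal_of_proj
      (fun k => QuotientAddGroup.map N.toAddSubgroup N.toAddSubgroup (M.proj k)
        fun m hm => hN k m hm) ?_ ?_ ?_
    · rintro k _ ⟨m, hm, rfl⟩
      exact congrArg N.mkQ (internalProj_same M.isInternal k m hm)
    · rintro k l hkl _ ⟨m, hm, rfl⟩
      exact (congrArg N.mkQ (internalProj_ne M.isInternal k l hkl m hm)).trans (map_zero _)
    · intro m
      obtain ⟨m, rfl⟩ := N.mkQ_surjective m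
      refine internal_induction M.isInternal (p := fun m => N.mkQ m ∈ _) ?_ ?_ ?_ m
      · intro k m hm
        exact AddSubgroup.mem_iSup_of_mem k ⟨m, hm, rfl⟩
      · rw [map_zero]; exact zero_mem _
      · intro x y hx hy
        rw [map_add]; exact add_mem hx hy
  smul_mem := by
    rintro i k a _ ha ⟨m, hm, rfl⟩
    exact ⟨a • m, M.smul_mem i k a m ha hm, rfl⟩

/-- The product of two graded modules. -/
def prod (M N : GrMod 𝒜) : GrMod 𝒜 where
  carrier := M × N
  grading k := (M.grading k).prod (N.grading k)
  isInternal := by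
    refine isInternal_of_proj (fun k => (M.proj k).prodMap (N.proj k)) ?_ ?_ ?_
    · intro k m hm
      exact Prod.ext (internalProj_same M.isInternal k _ hm.1)
        (internalProj_same N.isInternal k _ hm.2)
    · intro k l hkl m hm
      exact Prod.ext (internalProj_ne M.isInternal k l hkl _ hm.1)
        (internalProj_ne N.isInternal k l hkl _ hm.2)
    · rintro ⟨x, y⟩
      have hx : (x, (0 : N)) ∈ ⨆ k, (M.grading k).prod (N.grading k) := by
        refine internal_induction M.isInternal
          (p := fun x => (x, (0 : N)) ∈ ⨆ k, (M.grading k).prod (N.grading k)) ?_ ?_ ?_ x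
        · intro k m hm
          exact AddSubgroup.mem_iSup_of_mem k ⟨hm, zero_mem _⟩
        · exact zero_mem _
        · intro x y hx hy
          simpa using add_mem hx hy
      have hy : ((0 : M), y) ∈ ⨆ k, (M.grading k).prod (N.grading k) := by
        refine internal_induction N.isInternal
          (p := fun y => ((0 : M), y) ∈ ⨆ k, (M.grading k).prod (N.grading k)) ?_ ?_ ?_ y
        · intro k m hm
          exact AddSubgroup.mem_iSup_of_mem k ⟨zero_mem _, hm⟩
        · exact zero_mem _
        · intro x y hx hy
          simpa using add_mem hx hy
      simpa using add_mem hx hy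
  smul_mem i k a m ha hm :=
    ⟨M.smul_mem i k a m.1 ha hm.1, N.smul_mem i k a m.2 ha hm.2⟩

/-- The zero graded module. -/
def zeroObj (𝒜 : ℕ → AddSubgroup A) : GrMod 𝒜 where
  carrier := PUnit
  grading _ := ⊤
  isInternal := isInternal_of_proj (fun _ => 0) (fun _ _ _ => rfl) (fun _ _ _ _ _ => rfl)
    fun _ => AddSubgroup.mem_iSup_of_mem 0 trivial
  smul_mem _ _ _ _ _ _ := trivial

theorem ker_homogeneous {M N : GrMod 𝒜} (f : M ⟶ N) (k : ℤ) (m : M)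
    (hm : m ∈ LinearMap.ker (lin f)) : M.proj k m ∈ LinearMap.ker (lin f) := by
  rw [LinearMap.mem_ker] at hm ⊢
  rw [lin_proj, hm, map_zero]

theorem range_homogeneous {M N : GrMod 𝒜} (f : M ⟶ N) (k : ℤ) (m : N)
    (hm : m ∈ LinearMap.range (lin f)) : N.proj k m ∈ LinearMap.range (lin f) := by
  obtain ⟨x, rfl⟩ := hm
  exact ⟨M.proj k x, lin_proj f k x⟩

/-- The inclusion of a graded submodule. -/
def subι (M : GrMod 𝒜) (N : Submodule A M) (hN : ∀ k, ∀ m ∈ N, M.proj k m ∈ N) :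
    M.sub N hN ⟶ M := ofLin (M := M.sub N hN) N.subtype fun _ _ h => h

/-- The projection to a graded quotient. -/
def quotπ (M : GrMod 𝒜) (N : Submodule A M) (hN : ∀ k, ∀ m ∈ N, M.proj k m ∈ N) :
    M ⟶ M.quot N hN := ofLin (N := M.quot N hN) N.mkQ fun _ m h => ⟨m, h, rfl⟩

/-! #### The category of graded modules is abelian -/

section Abelian

variable {M N : GrMod 𝒜}

/-- The kernel of `f` is the submodule `ker f`. -/
def kernelIsLimit (f : M ⟶ N) :
    IsLimit (KernelFork.ofι (f := f) (M.subι (LinearMap.ker (lin f)) (ker_homogeneous f))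
      (hom_ext fun m => m.2)) :=
  KernelFork.IsLimit.ofι _ _
    (fun g hg => ofLin (N := M.sub (LinearMap.ker (lin f)) (ker_homogeneous f))
      (LinearMap.codRestrict (LinearMap.ker (lin f)) (lin g)
        fun m => LinearMap.congr_fun (congrArg lin hg) m)
      fun k m h => lin_mem g k m h)
    (fun _ _ => rfl)
    (fun _ _ _ hb => hom_ext fun m => Subtype.ext (LinearMap.congr_fun (congrArg lin hb) m))

/-- The cokernel of `f` is the quotient module by `range f`. -/
def cokernelIsColimit (f : M ⟶ N) :
    IsColimit (CokernelCofork.ofπ (f := f)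
      (N.quotπ (LinearMap.range (lin f)) (range_homogeneous f))
      (hom_ext fun m => (Submodule.Quotient.mk_eq_zero _).2 ⟨m, rfl⟩)) :=
  CokernelCofork.IsColimit.ofπ _ _
    (fun {Z} g hg => ofLin (M := N.quot (LinearMap.range (lin f)) (range_homogeneous f)) (N := Z)
      ((LinearMap.range (lin f)).liftQ (lin g) (by
        rintro _ ⟨m, rfl⟩
        exact LinearMap.congr_fun (congrArg lin hg) m))
      (by
        rintro k _ ⟨m, h, rfl⟩
        exact lin_mem g k m h))
    (fun _ _ => rfl)
    (fun _ _ _ hb => hom_ext fun m => by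
      obtain ⟨m, rfl⟩ := Submodule.mkQ_surjective _ m
      exact LinearMap.congr_fun (congrArg lin hb) m)

instance : HasKernels (GrMod 𝒜) := ⟨fun f => ⟨⟨_, kernelIsLimit f⟩⟩⟩

instance : HasCokernels (GrMod 𝒜) := ⟨fun f => ⟨⟨_, cokernelIsColimit f⟩⟩⟩

theorem injective_of_mono (f : M ⟶ N) [Mono f] : Function.Injective (lin f) := by
  rw [injective_iff_map_eq_zero]
  intro m hm
  have h : M.subι (LinearMap.ker (lin f)) (ker_homogeneous f) = 0 := by
    rw [← cancel_mono f]
    exact hom_ext fun x => x.2.trans (by simp)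
  exact LinearMap.congr_fun (congrArg lin h) ⟨m, hm⟩

theorem surjective_of_epi (f : M ⟶ N) [Epi f] : Function.Surjective (lin f) := by
  intro n
  have h : N.quotπ (LinearMap.range (lin f)) (range_homogeneous f) = 0 := by
    rw [← cancel_epi f]
    exact hom_ext fun x => (Submodule.Quotient.mk_eq_zero _).2 ⟨x, rfl⟩
  exact (Submodule.Quotient.mk_eq_zero _).1 (LinearMap.congr_fun (congrArg lin h) n)

/-- The inverse of an injective morphism on its range preserves degrees. -/
theorem mem_of_injective (f : M ⟶ N) (hf : Function.Injective (lin f)) (k : ℤ) (m : M)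
    (h : lin f m ∈ N.grading k) : m ∈ M.grading k := by
  have : lin f (M.proj k m) = lin f m := by
    rw [lin_proj]; exact internalProj_same _ _ _ h
  rw [← hf this]
  exact internalProj_mem _ _ _

/-- Homogeneous elements lift to homogeneous elements along surjections. -/
theorem exists_mem_of_surjective (f : M ⟶ N) (hf : Function.Surjective (lin f)) (k : ℤ) (n : N)
    (h : n ∈ N.grading k) : ∃ m ∈ M.grading k, lin f m = n := by
  obtain ⟨m, rfl⟩ := hf n
  refine ⟨M.proj k m, internalProj_mem _ _ _, ?_⟩
  rw [lin_proj]; exact internalProj_same _ _ _ h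

/-- A monomorphism is the kernel of its cokernel. -/
theorem normalMono (f : M ⟶ N) [Mono f] : Nonempty (NormalMono f) := ⟨{
  Z := N.quot (LinearMap.range (lin f)) (range_homogeneous f)
  g := N.quotπ (LinearMap.range (lin f)) (range_homogeneous f)
  w := hom_ext fun m => (Submodule.Quotient.mk_eq_zero _).2 ⟨m, rfl⟩
  isLimit := by
    have hr : ∀ {Z : GrMod 𝒜} (g : Z ⟶ N),
        g ≫ N.quotπ (LinearMap.range (lin f)) (range_homogeneous f) = 0 →
        ∀ z, lin g z ∈ LinearMap.range (lin f) := fun g hg z =>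
      (Submodule.Quotient.mk_eq_zero _).1 (LinearMap.congr_fun (congrArg lin hg) z)
    have hl : ∀ {Z : GrMod 𝒜} (g : Z ⟶ N)
        (hg : g ≫ N.quotπ (LinearMap.range (lin f)) (range_homogeneous f) = 0) (z : Z),
        lin f (((LinearEquiv.ofInjective (lin f) (injective_of_mono f)).symm.toLinearMap ∘ₗ
          LinearMap.codRestrict _ (lin g) (hr g hg)) z) = lin g z := fun g hg z =>
      congrArg Subtype.val ((LinearEquiv.ofInjective (lin f) (injective_of_mono f)).apply_symm_apply
        ⟨lin g z, hr g hg z⟩)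
    exact KernelFork.IsLimit.ofι _ _
      (fun {Z} g hg => ofLin (M := Z) (N := M)
        ((LinearEquiv.ofInjective (lin f) (injective_of_mono f)).symm.toLinearMap ∘ₗ
          LinearMap.codRestrict _ (lin g) (hr g hg))
        (fun k z h => mem_of_injective f (injective_of_mono f) k _ (by
          rw [hl g hg]; exact lin_mem g k z h)))
      (fun g hg => hom_ext fun z => hl g hg z)
      (fun g hg b hb => (cancel_mono f).1 (hb.trans (hom_ext fun z => (hl g hg z).symm))) }⟩

/-- An epimorphism is the cokernel of its kernel. -/
theorem normalEpi (f : M ⟶ N) [Epi f] : Nonempty (NormalEpi f) := ⟨{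
  W := M.sub (LinearMap.ker (lin f)) (ker_homogeneous f)
  g := M.subι (LinearMap.ker (lin f)) (ker_homogeneous f)
  w := hom_ext fun m => m.2
  isColimit := by
    have hk : ∀ {Z : GrMod 𝒜} (g : M ⟶ Z),
        M.subι (LinearMap.ker (lin f)) (ker_homogeneous f) ≫ g = 0 →
        LinearMap.ker (lin f) ≤ LinearMap.ker (lin g) := fun g hg m hm =>
      LinearMap.congr_fun (congrArg lin hg) ⟨m, hm⟩
    have hl : ∀ {Z : GrMod 𝒜} (g : M ⟶ Z)
        (hg : M.subι (LinearMap.ker (lin f)) (ker_homogeneous f) ≫ g = 0) (m : M),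
        ((LinearMap.ker (lin f)).liftQ (lin g) (hk g hg) ∘ₗ
          ((lin f).quotKerEquivOfSurjective (surjective_of_epi f)).symm.toLinearMap) (lin f m) =
          lin g m := fun g hg m => by
      have : ((lin f).quotKerEquivOfSurjective (surjective_of_epi f)).symm (lin f m) =
          (LinearMap.ker (lin f)).mkQ m := by
        rw [LinearEquiv.symm_apply_eq]; rfl
      rw [LinearMap.comp_apply, LinearEquiv.coe_coe, this]
      rfl
    exact CokernelCofork.IsColimit.ofπ _ _
      (fun {Z} g hg => ofLin (M := N) (N := Z)
        ((LinearMap.ker (lin f)).liftQ (lin g) (hk g hg) ∘ₗ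
          ((lin f).quotKerEquivOfSurjective (surjective_of_epi f)).symm.toLinearMap)
        (fun k n h => by
          obtain ⟨m, hm, rfl⟩ := exists_mem_of_surjective f (surjective_of_epi f) k n h
          rw [hl g hg]; exact lin_mem g k m hm))
      (fun g hg => hom_ext fun z => hl g hg z)
      (fun g hg b hb => (cancel_epi f).1 (hb.trans (hom_ext fun z => (hl g hg z).symm))) }⟩

instance : HasZeroObject (GrMod 𝒜) :=
  ⟨⟨zeroObj 𝒜, fun _ => ⟨⟨⟨0⟩, fun f => hom_ext fun m =>
      (congrArg (lin f) (Subsingleton.elim (α := PUnit) m 0)).trans (map_zero (lin f))⟩⟩,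
    fun _ => ⟨⟨⟨0⟩, fun _ => hom_ext fun _ => Subsingleton.elim (α := PUnit) _ _⟩⟩⟩⟩

/-- The biproduct of `M` and `N`. -/
def prodBicone (M N : GrMod 𝒜) : BinaryBicone M N where
  pt := prod M N
  fst := ofLin (M := prod M N) (LinearMap.fst A M N) fun _ _ h => h.1
  snd := ofLin (M := prod M N) (LinearMap.snd A M N) fun _ _ h => h.2
  inl := ofLin (N := prod M N) (LinearMap.inl A M N) fun _ _ h => ⟨h, zero_mem _⟩
  inr := ofLin (N := prod M N) (LinearMap.inr A M N) fun _ _ h => ⟨zero_mem _, h⟩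
  inl_fst := rfl
  inl_snd := rfl
  inr_fst := rfl
  inr_snd := rfl

instance : HasBinaryBiproducts (GrMod 𝒜) :=
  ⟨fun M N => hasBinaryBiproduct_of_total (prodBicone M N) (hom_ext fun (m : M × N) => by
    change ((m.1, (0 : N)) + ((0 : M), m.2) : M × N) = m
    simp)⟩

instance : HasFiniteProducts (GrMod 𝒜) := hasFiniteProducts_of_has_binary_and_terminal

instance : Abelian (GrMod 𝒜) where
  normalMonoOfMono f _ := normalMono f
  normalEpiOfEpi f _ := normalEpi f

end Abelian

instance : HasExt.{u + 1} (GrMod 𝒜) := HasExt.standard _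

/-! #### Shifts -/

/-- The shift `M(l)`: the same module, with `M(l)ₖ = Mₖ₊ₗ`. -/
def shift (M : GrMod 𝒜) (l : ℤ) : GrMod 𝒜 where
  carrier := M
  grading k := M.grading (k + l)
  isInternal := by
    refine isInternal_of_proj (fun k => M.proj (k + l)) ?_ ?_ ?_
    · intro k m hm
      exact internalProj_same M.isInternal _ _ hm
    · intro k k' h m hm
      exact internalProj_ne M.isInternal _ _ (by simpa using h) _ hm
    · intro m
      refine internal_induction M.isInternal (p := fun m => m ∈ ⨆ k, M.grading (k + l)) ?_ ?_ ?_ m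
      · intro k m hm
        refine AddSubgroup.mem_iSup_of_mem (k - l) ?_
        rwa [sub_add_cancel]
      · exact zero_mem _
      · intro x y hx hy
        exact add_mem hx hy
  smul_mem i k a m ha hm := by
    have := M.smul_mem i (k + l) a m ha hm
    rwa [← add_assoc] at this

/-- The shift functor. -/
def shiftFunctor (𝒜 : ℕ → AddSubgroup A) (l : ℤ) : GrMod 𝒜 ⥤ GrMod 𝒜 where
  obj M := M.shift l
  map {M N} f := ofLin (M := M.shift l) (N := N.shift l) (lin (M := M) (N := N) f)
    fun k m h => lin_mem (M := M) (N := N) f (k + l) m h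

/-- The identity map `M(l)(k) → M(k + l)`. -/
def shiftShift (M : GrMod 𝒜) (k l : ℤ) :
    (shiftFunctor 𝒜 k).obj ((shiftFunctor 𝒜 l).obj M) ⟶ (shiftFunctor 𝒜 (k + l)).obj M :=
  ofLin (M := (M.shift l).shift k) (N := M.shift (k + l)) LinearMap.id
    fun i m (hm : m ∈ M.grading _) => by
      change m ∈ M.grading _
      rwa [← add_assoc]

instance (l : ℤ) : (shiftFunctor 𝒜 l).Additive where
  map_add := rfl

instance (l : ℤ) : (shiftFunctor 𝒜 l).IsEquivalence where
  faithful := ⟨fun {M N} f g h => hom_ext fun m =>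
    LinearMap.congr_fun (congrArg (lin (M := M.shift l) (N := N.shift l)) h) m⟩
  full := ⟨fun {M N} g => ⟨ofLin (M := M) (N := N) (lin (M := M.shift l) (N := N.shift l) g)
    fun k m h => by
      have := lin_mem (M := M.shift l) (N := N.shift l) g (k - l) m
        (by change m ∈ M.grading _; rwa [sub_add_cancel])
      change _ ∈ N.grading _ at this
      rwa [sub_add_cancel] at this, rfl⟩⟩
  essSurj := ⟨fun M => ⟨M.shift (-l), ⟨{
    hom := ofLin (M := (M.shift (-l)).shift l) (N := M) LinearMap.id
      fun k m (h : m ∈ M.grading _) => by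
        rw [add_neg_cancel_right] at h; exact h
    inv := ofLin (M := M) (N := (M.shift (-l)).shift l) LinearMap.id fun k m h => by
      change m ∈ M.grading _
      rwa [add_neg_cancel_right]
    hom_inv_id := rfl
    inv_hom_id := rfl }⟩⟩⟩

/-! ### Graded Ext groups and Yoneda products -/

/-- The graded Ext group `Extⁿ(M, N) = ⨁ₗ Extⁿ_{Gr A}(M, N(l))`, where `Gr A` is the category of
graded `A`-modules and degree-preserving maps. -/
abbrev GExt (M N : GrMod 𝒜) (n : ℕ) : Type (u + 1) :=
  ⨁ l : ℤ, Abelian.Ext.{u + 1} M ((shiftFunctor 𝒜 l).obj N) n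

/-- The Yoneda product on homogeneous elements: for `α ∈ Extⁱ(X, Y(a))` and `β ∈ Extʲ(Y, Z(b))`,
it is the composite of `α` with `β(a) ∈ Extʲ(Y(a), Z(b)(a))`, where `Z(b)(a) = Z(a + b)`. -/
noncomputable def yonedaHom {X Y Z : GrMod 𝒜} {i j n : ℕ} (h : i + j = n) (a b : ℤ)
    (β : Abelian.Ext.{u + 1} Y ((shiftFunctor 𝒜 b).obj Z) j) (α : Abelian.Ext.{u + 1} X ((shiftFunctor 𝒜 a).obj Y) i) :
    Abelian.Ext.{u + 1} X ((shiftFunctor 𝒜 (a + b)).obj Z) n :=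
  (α.comp (β.mapExactFunctor (shiftFunctor 𝒜 a)) h).comp
    (Abelian.Ext.mk₀ (Z.shiftShift a b)) (add_zero n)

/-- The homogeneous Yoneda product as a biadditive map with values in the graded Ext group. -/
noncomputable def yonedaHomAdd {X Y Z : GrMod 𝒜} {i j n : ℕ} (h : i + j = n) (a b : ℤ) :
    Abelian.Ext.{u + 1} Y ((shiftFunctor 𝒜 b).obj Z) j →+
      Abelian.Ext.{u + 1} X ((shiftFunctor 𝒜 a).obj Y) i →+ GExt X Z n :=
  AddMonoidHom.mk' (fun β => AddMonoidHom.mk'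
      (fun α => DirectSum.of
        (fun l => Abelian.Ext.{u + 1} X ((shiftFunctor 𝒜 l).obj Z) n) (a + b) (yonedaHom h a b β α))
      (fun α α' => by simp only [yonedaHom, Abelian.Ext.add_comp, map_add]))
    (fun β β' => AddMonoidHom.ext fun α => by
      simp [yonedaHom, Abelian.Ext.add_comp])

/-- The Yoneda product `(β, α) ↦ β · α`, `Extʲ(Y, Z) × Extⁱ(X, Y) → Extⁿ(X, Z)`, `n = i + j`, of
graded Ext groups: the biadditive extension of the product of homogeneous elements. -/
noncomputable def yoneda {X Y Z : GrMod 𝒜} {i j n : ℕ} (h : i + j = n) :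
    GExt Y Z j →+ GExt X Y i →+ GExt X Z n :=
  DirectSum.toAddMonoid fun b => AddMonoidHom.flip <|
    DirectSum.toAddMonoid fun a => AddMonoidHom.flip (yonedaHomAdd h a b)

/-- The product `Extʲ(Y, Z) · Extⁱ(X, Y)`: the subgroup of `Extⁿ(X, Z)`, `n = i + j`, of all finite
sums of Yoneda products `β · α`. -/
noncomputable def yonedaSpan (X Y Z : GrMod 𝒜) (j i n : ℕ) (h : i + j = n) :
    AddSubgroup (GExt X Z n) :=
  AddSubgroup.closure {γ | ∃ (β : GExt Y Z j) (α : GExt X Y i), γ = yoneda h β α}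

/-- The Yoneda Ext ring `⨁ₙ Extⁿ(S, S)` is generated by `Ext¹(S, S)` over `Hom(S, S)`: the only
graded subring `⨁ₙ Tₙ` that contains `Ext⁰(S, S) = Hom(S, S)` and `Ext¹(S, S)` is the whole
ring. -/
def ExtRingGeneratedByDegreeOne (S : GrMod 𝒜) : Prop :=
  ∀ T : (n : ℕ) → AddSubgroup (GExt S S n), T 0 = ⊤ → T 1 = ⊤ →
    (∀ (i j n : ℕ) (h : i + j = n), ∀ β ∈ T j, ∀ α ∈ T i, yoneda h β α ∈ T n) →
    ∀ n, T n = ⊤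

/-! ### Graded projective resolutions -/

/-- A graded projective resolution `⋯ → P₁ → P₀ → M → 0`; `ε` is `d₀ : P₀ → M` and `d n` is
`dₙ₊₁ : Pₙ₊₁ → Pₙ`. -/
structure GrProjRes (M : GrMod 𝒜) where
  P : ℕ → GrMod 𝒜
  projective : ∀ n, Projective (P n)
  ε : P 0 ⟶ M
  d : ∀ n, P (n + 1) ⟶ P n
  ε_surjective : Function.Surjective (lin ε)
  exact_zero : LinearMap.range (lin (d 0)) = LinearMap.ker (lin ε)
  exact_succ : ∀ n, LinearMap.range (lin (d (n + 1))) = LinearMap.ker (lin (d n))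

/-- `Ker dₙ ⊆ Pₙ`. -/
def GrProjRes.kerD {M : GrMod 𝒜} (R : GrProjRes M) : (n : ℕ) → Submodule A (R.P n)
  | 0 => LinearMap.ker (lin R.ε)
  | n + 1 => LinearMap.ker (lin (R.d n))

/-- `M` is bounded below. -/
def IsBoundedBelow (M : GrMod 𝒜) : Prop := ∃ l : ℤ, ∀ k < l, M.grading k = ⊥

section Koszul

variable [GradedRing 𝒜]

/-- The resolution is minimal: `Im dₙ₊₁ ⊆ J Pₙ` for all `n ≥ 0`. -/
def GrProjRes.IsMinimal {M : GrMod 𝒜} (R : GrProjRes M) : Prop :=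
  ∀ n, LinearMap.range (lin (R.d n)) ≤ gradedRadical 𝒜 • (⊤ : Submodule A (R.P n))

/-- `M` is quasi-Koszul: it has a minimal graded projective resolution, and in its (essentially
unique) minimal graded projective resolution, `J Ker dₙ = Ker dₙ ∩ J² Pₙ` for all `n ≥ 0`. -/
def IsQuasiKoszul (M : GrMod 𝒜) : Prop :=
  (∃ R : GrProjRes M, R.IsMinimal) ∧
    ∀ R : GrProjRes M, R.IsMinimal → ∀ n,
      gradedRadical 𝒜 • R.kerD n =
        R.kerD n ⊓ gradedRadical 𝒜 • gradedRadical 𝒜 • (⊤ : Submodule A (R.P n))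

/-- `M` is left finite: every component `Mₖ` is a finitely generated `A₀`-module. -/
def IsLeftFinite (M : GrMod 𝒜) : Prop := ∀ k, IsFGOverDegreeZero 𝒜 (M.grading k)

end Koszul

/-! ### The graded modules `A` and `S = A / J` -/

section Regular

variable (𝒜) [GradedRing 𝒜]

theorem intGrading_isInternal : DirectSum.IsInternal (intGrading 𝒜) := by
  refine isInternal_of_proj (fun
    | Int.ofNat n => GradedRing.proj 𝒜 n
    | Int.negSucc _ => 0) ?_ ?_ ?_
  · rintro (k | k) m hm
    · exact DirectSum.decompose_of_mem_same 𝒜 hm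
    · exact ((AddSubgroup.mem_bot).1 hm).symm
  · rintro (k | k) (l | l) hkl m hm
    · exact DirectSum.decompose_of_mem_ne 𝒜 hm (fun h => hkl (by rw [h]))
    · rw [(AddSubgroup.mem_bot).1 hm, map_zero]
    · rfl
    · rfl
  · intro m
    classical
    rw [← DirectSum.sum_support_decompose 𝒜 m]
    exact sum_mem fun k _ => AddSubgroup.mem_iSup_of_mem (Int.ofNat k) (SetLike.coe_mem _)

/-- `A` as a graded module over itself. -/
def regular : GrMod 𝒜 where
  carrier := A
  grading := intGrading 𝒜
  isInternal := intGrading_isInternal 𝒜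
  smul_mem := by
    rintro i (k | k) a m ha hm
    · exact SetLike.mul_mem_graded (A := 𝒜) ha hm
    · rw [(AddSubgroup.mem_bot).1 hm, smul_zero]; exact zero_mem _

theorem gradedRadical_homogeneous (k : ℤ) (a : A) (ha : a ∈ gradedRadical 𝒜) :
    internalProj (intGrading_isInternal 𝒜) k a ∈ gradedRadical 𝒜 := by
  have hne : ∀ l : ℤ, l ≠ 0 → ∀ x ∈ intGrading 𝒜 l, GradedRing.projZeroRingHom' 𝒜 x = 0 := by
    rintro (l | l) hl x hx
    · exact Subtype.ext (DirectSum.decompose_of_mem_ne 𝒜 hx (fun h => hl (by rw [h]; rfl)))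
    · rw [(AddSubgroup.mem_bot).1 hx, map_zero]
  rw [gradedRadical, Ideal.mem_comap] at ha ⊢
  by_cases hk : k = 0
  · subst hk
    have : ∀ x : A, GradedRing.projZeroRingHom' 𝒜
        (internalProj (intGrading_isInternal 𝒜) 0 x) = GradedRing.projZeroRingHom' 𝒜 x := by
      refine internal_induction (intGrading_isInternal 𝒜) ?_ ?_ ?_
      · intro l x hx
        by_cases hl : 0 = l
        · subst hl
          rw [internalProj_same _ _ _ hx]
        · rw [hne l (Ne.symm hl) x hx, internalProj_ne _ _ _ hl _ hx, map_zero]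
      · rw [map_zero]
      · intro x y hx hy
        rw [map_add, map_add, map_add, hx, hy]
    rw [this]; exact ha
  · rw [hne k hk _ (internalProj_mem _ k a)]
    exact zero_mem _

/-- The graded `A`-module `S = A / J`. -/
noncomputable def simpleTop : GrMod 𝒜 := (regular 𝒜).quot (gradedRadical 𝒜) (gradedRadical_homogeneous 𝒜)

end Regular

end GrMod

/-! Let `P` be a minimal resolution of `M` with syzygies `Ωⁿ`, so that `Ωⁿ⁺¹ = Ker dₙ ⊆ J Pₙ`. A map
from `Pₙ` to a shift of `S` kills `J Pₙ`, hence restricts to zero on `Ωⁿ⁺¹`. Dimension shifting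
therefore gives `Extⁿ(M, S(l)) ≅ Hom(Ωⁿ, S(l))` (`IsMinimal.extEquiv`).

Since `A` is projective, every class in `Ext¹(S, S(b))` is the pushforward of `J → A → S` along some
`g : J → S(b)`. To multiply it with the class of `f : Ωⁿ → S(a)`, lift `f` to `h : Pₙ → A(a)`. The
restriction of `h` maps `Ωⁿ⁺¹` to `J(a)`, and the product is represented by `Ωⁿ⁺¹ → J(a) → S(a + b)`
(`IsMinimal.yonedaHom_radicalClass`). So part (1) asks when such composites span all maps `Ωⁿ⁺¹ →
S(l)`.

All these composites kill `Ωⁿ⁺¹ ∩ J² Pₙ`, because `h` maps `J² Pₙ` into `J²` and `g` kills `J²`.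
Maps to shifts of `S` separate the elements of `Ωⁿ⁺¹ / J Ωⁿ⁺¹`, since `A / J` is semisimple. Hence
spanning forces `Ωⁿ⁺¹ ∩ J² Pₙ ⊆ J Ωⁿ⁺¹`. Conversely, under this inclusion a map `u : Ωⁿ⁺¹ → S(l)`
factors through the image of `Ωⁿ⁺¹` in the semisimple module `J Pₙ / J² Pₙ` and extends to `J Pₙ`.
Expanding elements in a homogeneous dual basis of `Pₙ` then writes `u` as a finite sum of composites
of the required form (`DualBasis.exists_factorization`).

The dual bases come from a minimal resolution by sums of modules `A e(-d)`, with `e` an idempotent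
of degree zero and finitely many summands below any given degree. It is obtained by iterating
projective covers (`exists_projectiveCover`): idempotents lift from `A / J`, graded Nakayama gives
surjectivity, and the noetherian hypothesis keeps the syzygies left finite.

Part (2) is part (1) for `M = S`, combined with associativity of the product. Reassociation is only
needed when the leftmost factor has degree `0` or `1`, where compatibility with iterated shifts can
be checked on maps and on the extension `J → A → S`. -/

section Semisimple

/-! ### Modules over a semisimple quotient ring -/

variable {A : Type*} [Ring A] (I : Ideal A) [I.IsTwoSided] {W : Type*} [AddCommGroup W] [Module A W]

theorem isSemisimpleModule_of_smul_eq_zero [IsSemisimpleRing (A ⧸ I)]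
    (h : ∀ a ∈ I, ∀ w : W, a • w = 0) : IsSemisimpleModule A W := by
  have ht : Module.IsTorsionBySet A W (I : Set A) := fun w a => h a a.2 w
  let _ := ht.module
  exact ht.isSemisimpleModule_iff.1 inferInstance

/-- A cyclic module `A x` killed by `I` with `A ⧸ I` semisimple is isomorphic to `(A ⧸ I) f` with
`f` idempotent modulo `I`. -/
theorem exists_idempotent_of_cyclic [IsSemisimpleRing (A ⧸ I)] (x : W)
    (h : ∀ a ∈ I, a • x = 0) :
    ∃ f : A, f * f - f ∈ I ∧ f • x = x ∧ ∀ c : A, c • x = 0 ↔ c * f ∈ I := by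
  have hss : IsSemisimpleModule A (A ⧸ I) := isSemisimpleModule_of_smul_eq_zero I (by
    rintro a ha ⟨w⟩
    exact (Submodule.Quotient.mk_eq_zero _).2 (I.mul_mem_right w ha))
  set N : Submodule A A := LinearMap.ker (LinearMap.toSpanSingleton A W x) with hN
  have hmem : ∀ c, c ∈ N ↔ c • x = 0 := fun c => by simp [hN]
  -- A complement `C` of the annihilator of `x` modulo `I` is a copy of `A x` inside `A ⧸ I`. The
  -- component of `1` in `C` is the wanted `f`.
  obtain ⟨C, hC⟩ := exists_isCompl (N.map I.mkQ)
  have htop : I.mkQ 1 ∈ N.map I.mkQ ⊔ C := by rw [hC.sup_eq_top]; trivial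
  obtain ⟨_, ⟨n, hn, rfl⟩, z, hz, hsum⟩ := Submodule.mem_sup.1 htop
  obtain ⟨f, rfl⟩ := I.mkQ_surjective z
  have hI : 1 - (n + f) ∈ I := by
    rw [← map_add] at hsum
    exact (Submodule.Quotient.eq I).1 hsum.symm
  have hn' : n • x = 0 := (hmem n).1 hn
  have hfx : f • x = x := by
    have := h _ hI
    rw [sub_smul, one_smul, add_smul, hn', zero_add, sub_eq_zero] at this
    exact this.symm
  have key : ∀ c : A, c • x = 0 ↔ c * f ∈ I := by
    intro c
    constructor
    · intro hc
      have h1 : c * f ∈ N := by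
        rw [hmem, mul_smul, hfx, hc]
      have h2 : I.mkQ (c * f) ∈ C := by
        have := C.smul_mem c hz
        rwa [← map_smul, smul_eq_mul] at this
      have h3 : I.mkQ (c * f) ∈ N.map I.mkQ ⊓ C := ⟨⟨_, h1, rfl⟩, h2⟩
      rw [hC.inf_eq_bot] at h3
      exact (Submodule.Quotient.mk_eq_zero _).1 h3
    · intro hc
      have := h _ hc
      rwa [mul_smul, hfx] at this
  refine ⟨f, ?_, hfx, key⟩
  -- `f` fixes `x`, so `f - 1` annihilates it, and the annihilator criterion turns this into
  -- idempotency modulo `I`.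
  have := (key (f - 1)).1 (by rw [sub_smul, hfx, one_smul, sub_self])
  rwa [sub_mul, one_mul] at this

/-- Maps to `A ⧸ I` separate the elements of a module killed by `I` if `A ⧸ I` is semisimple. -/
theorem exists_linearMap_apply_ne_zero [IsSemisimpleRing (A ⧸ I)]
    (h : ∀ a ∈ I, ∀ w : W, a • w = 0) (x : W) (hx : x ≠ 0) :
    ∃ φ : W →ₗ[A] A ⧸ I, φ x ≠ 0 := by
  have hss : IsSemisimpleModule A W := isSemisimpleModule_of_smul_eq_zero I h
  obtain ⟨f, -, -, hf⟩ := exists_idempotent_of_cyclic I x fun a ha => h a ha x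
  let t := LinearMap.toSpanSingleton A W x
  let g : A →ₗ[A] A ⧸ I := I.mkQ ∘ₗ LinearMap.toSpanSingleton A A f
  have hker : LinearMap.ker t ≤ LinearMap.ker g := by
    intro c hc
    exact (Submodule.Quotient.mk_eq_zero _).2 ((hf c).1 hc)
  -- `ψ` sends `c • x` to the class of `c * f`. It extends to `W` by semisimplicity, and `ψ x = 0`
  -- would give `f ∈ I`, hence `x = 0`.
  let ψ : LinearMap.range t →ₗ[A] A ⧸ I :=
    (LinearMap.ker t).liftQ g hker ∘ₗ t.quotKerEquivRange.symm.toLinearMap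
  obtain ⟨φ, hφ⟩ := IsSemisimpleModule.extension_property (LinearMap.range t).subtype
    (Submodule.subtype_injective _) ψ
  refine ⟨φ, fun h0 => hx ?_⟩
  have hx1 : t 1 = x := by simp [t]
  have h1 : φ x = ψ ⟨t 1, 1, rfl⟩ := by
    rw [← hφ]; simp [hx1]
  have h2 : t.quotKerEquivRange.symm ⟨t 1, 1, rfl⟩ = (LinearMap.ker t).mkQ 1 := by
    rw [LinearEquiv.symm_apply_eq]; rfl
  have h3 : g 1 = 0 := by
    rw [← h0, h1]
    simp only [ψ, LinearMap.comp_apply, LinearEquiv.coe_coe, h2]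
    rfl
  have h4 : (1 : A) * f ∈ I := (Submodule.Quotient.mk_eq_zero _).1 h3
  rw [← one_smul A x]
  exact (hf 1).2 h4

/-- A finitely generated module killed by `I`, with `A ⧸ I` semisimple, is a finite direct sum of
modules `(A ⧸ I) f` with `f` idempotent modulo `I`. -/
theorem exists_idempotent_decomposition [IsSemisimpleRing (A ⧸ I)] [Module.Finite A W]
    (h : ∀ a ∈ I, ∀ w : W, a • w = 0) :
    ∃ (r : ℕ) (w : Fin r → W) (f : Fin r → A), (∀ i, f i * f i - f i ∈ I) ∧
      (∀ i, f i • w i = w i) ∧ (∀ x : W, ∃ c : Fin r → A, ∑ i, c i • w i = x) ∧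
      ∀ c : Fin r → A, ∑ i, c i • w i = 0 → ∀ i, c i * f i ∈ I := by
  classical
  have hss : IsSemisimpleModule A W := isSemisimpleModule_of_smul_eq_zero I h
  obtain ⟨r, S, e, hS⟩ := IsSemisimpleModule.exists_linearEquiv_fin_dfinsupp A W
  have hgen : ∀ i, ∃ t : S i, ∀ s : S i, ∃ c : A, c • t = s := fun i => by
    have := IsSimpleModule.nontrivial A (S i)
    obtain ⟨t, ht⟩ := exists_ne (0 : S i)
    refine ⟨t, fun s => ?_⟩
    exact IsSimpleModule.toSpanSingleton_surjective A ht s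
  choose t ht using hgen
  choose f hf1 hf2 hf3 using fun i => exists_idempotent_of_cyclic I (t i)
    fun a ha => Subtype.ext (h a ha (t i))
  have hsum : ∀ (c : Fin r → A) (j : Fin r),
      e (∑ i, c i • e.symm (DFinsupp.single i (t i))) j = c j • t j := by
    intro c j
    simp only [map_sum, map_smul, LinearEquiv.apply_symm_apply]
    rw [DFinsupp.finsetSum_apply, Finset.sum_eq_single j]
    · simp
    · intro i _ hij
      simp [DFinsupp.single_apply, hij]
    · simp
  refine ⟨r, fun i => e.symm (DFinsupp.single i (t i)), f, hf1, fun i => ?_, fun x => ?_,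
    fun c hc i => ?_⟩
  · rw [← map_smul, ← DFinsupp.single_smul, hf2]
  · choose c hc using fun i => ht i (e x i)
    refine ⟨c, e.injective (DFinsupp.ext fun j => ?_)⟩
    rw [hsum, hc]
  · rw [← hf3, ← hsum, hc]
    simp

end Semisimple

/-! ### The graded radical and its semisimple quotient -/

section GradedRing

variable {A : Type u} [Ring A]

theorem intGrading_eq_zero {𝒜 : ℕ → AddSubgroup A} {k : ℤ} (hk : k < 0) {a : A} (ha : a ∈ intGrading 𝒜 k) :
    a = 0 := by
  rcases k with k | k
  · exact absurd hk (by simp)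
  · exact (AddSubgroup.mem_bot).1 ha

variable (𝒜 : ℕ → AddSubgroup A) [GradedRing 𝒜]

instance gradedRadical_isTwoSided : (gradedRadical 𝒜).IsTwoSided := by
  unfold gradedRadical; infer_instance

theorem mem_gradedRadical_of_mem {n : ℕ} (hn : n ≠ 0) {a : A} (ha : a ∈ 𝒜 n) :
    a ∈ gradedRadical 𝒜 := by
  have : GradedRing.projZeroRingHom' 𝒜 a = 0 :=
    Subtype.ext (DirectSum.decompose_of_mem_ne 𝒜 ha hn)
  rw [gradedRadical, Ideal.mem_comap, this]
  exact zero_mem _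

theorem coe_mem_gradedRadical_iff (a : 𝒜 0) :
    (a : A) ∈ gradedRadical 𝒜 ↔ a ∈ Ring.jacobson (𝒜 0) := by
  rw [gradedRadical, Ideal.mem_comap, GradedRing.projZeroRingHom'_apply_coe]

theorem sub_projZero_mem_gradedRadical (a : A) :
    a - GradedRing.projZeroRingHom' 𝒜 a ∈ gradedRadical 𝒜 := by
  rw [gradedRadical, Ideal.mem_comap, map_sub, GradedRing.projZeroRingHom'_apply_coe, sub_self]
  exact zero_mem _

variable {𝒜}

/-- The projection to degree zero induces an isomorphism `A ⧸ J ≅ A₀ ⧸ J(A₀)`. -/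
theorem isSemisimpleRing_quotient_gradedRadical (h : IsSemiperfectRing (𝒜 0)) :
    IsSemisimpleRing (A ⧸ gradedRadical 𝒜) := by
  have := h.1
  let g : A →+* 𝒜 0 ⧸ Ring.jacobson (𝒜 0) :=
    (Ideal.Quotient.mk _).comp (GradedRing.projZeroRingHom' 𝒜)
  have hg : ∀ a ∈ gradedRadical 𝒜, g a = 0 := fun a ha => Ideal.Quotient.eq_zero_iff_mem.2 ha
  refine (RingEquiv.ofBijective (Ideal.Quotient.lift _ g hg) ⟨?_, ?_⟩).symm.isSemisimpleRing
  · rw [injective_iff_map_eq_zero]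
    intro x hx
    obtain ⟨a, rfl⟩ := Ideal.Quotient.mk_surjective x
    rw [Ideal.Quotient.lift_mk] at hx
    exact Ideal.Quotient.eq_zero_iff_mem.2 
      ((Ideal.Quotient.eq_zero_iff_mem (I := Ring.jacobson (𝒜 0))).1 hx)
  · exact Ideal.Quotient.lift_surjective_of_surjective _ _
      (Ideal.Quotient.mk_surjective.comp (GradedRing.projZeroRingHom'_surjective 𝒜))

/-- Idempotents modulo the graded radical lift to idempotents of degree zero. -/
theorem exists_idempotent_lift (h : IsSemiperfectRing (𝒜 0)) (f : A)
    (hf : f * f - f ∈ gradedRadical 𝒜) :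
    ∃ e ∈ 𝒜 0, e * e = e ∧ e - f ∈ gradedRadical 𝒜 := by
  obtain ⟨e, he, hef⟩ := h.2 (GradedRing.projZeroRingHom' 𝒜 f) (by
    rw [gradedRadical, Ideal.mem_comap, map_sub, map_mul] at hf
    exact hf)
  refine ⟨e, e.2, congrArg Subtype.val he, ?_⟩
  rw [gradedRadical, Ideal.mem_comap, map_sub, GradedRing.projZeroRingHom'_apply_coe]
  exact hef

/-- The component of degree `k` of `a`, where `A` is `ℤ`-graded by `intGrading`. -/
noncomputable def intComponent (𝒜 : ℕ → AddSubgroup A) [GradedRing 𝒜] (k : ℤ) : A →+ A :=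
  internalProj (GrMod.intGrading_isInternal 𝒜) k

theorem intComponent_mem (k : ℤ) (a : A) : intComponent 𝒜 k a ∈ intGrading 𝒜 k :=
  internalProj_mem _ _ _

theorem mem_gradedRadical_of_mem_intGrading {k : ℤ} (hk : k ≠ 0) {a : A}
    (ha : a ∈ intGrading 𝒜 k) : a ∈ gradedRadical 𝒜 := by
  rcases k with k | k
  · exact mem_gradedRadical_of_mem 𝒜 (fun h => hk (by rw [h]; rfl)) ha
  · rw [(AddSubgroup.mem_bot).1 ha]; exact zero_mem _

theorem mem_gradedRadical_of_components {a : A}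
    (h : ∀ k, intComponent 𝒜 k a ∈ gradedRadical 𝒜) : a ∈ gradedRadical 𝒜 := by
  obtain ⟨s, hs⟩ := exists_sum_internalProj (GrMod.intGrading_isInternal 𝒜) a
  rw [← hs]
  exact sum_mem fun k _ => h k

end GradedRing

/-! ### Homogeneous components and the graded Nakayama lemma -/

namespace GrMod

variable {A : Type u} [Ring A] {𝒜 : ℕ → AddSubgroup A}

section

variable (M : GrMod 𝒜)

theorem proj_mem (k : ℤ) (m : M) : M.proj k m ∈ M.grading k := internalProj_mem _ _ _

variable {M}

theorem proj_same {k : ℤ} {m : M} (hm : m ∈ M.grading k) : M.proj k m = m :=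
  internalProj_same _ _ _ hm

theorem proj_ne {k l : ℤ} (h : k ≠ l) {m : M} (hm : m ∈ M.grading l) : M.proj k m = 0 :=
  internalProj_ne _ _ _ h _ hm

theorem mem_of_proj_mem (N : AddSubgroup M) {m : M} (h : ∀ k, M.proj k m ∈ N) : m ∈ N := by
  obtain ⟨s, hs⟩ := exists_sum_internalProj M.isInternal m
  rw [← hs]
  exact sum_mem fun k _ => h k

theorem smul_mem_int {i k : ℤ} {a : A} {m : M} (ha : a ∈ intGrading 𝒜 i)
    (hm : m ∈ M.grading k) : a • m ∈ M.grading (i + k) := by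
  rcases i with i | i
  · exact M.smul_mem i k a m ha hm
  · rw [(AddSubgroup.mem_bot).1 ha, zero_smul]; exact zero_mem _

theorem proj_smul_of_mem {i : ℤ} {a : A} (ha : a ∈ intGrading 𝒜 i) (k : ℤ) (m : M) :
    M.proj k (a • m) = a • M.proj (k - i) m := by
  refine internal_induction M.isInternal
    (p := fun m => M.proj k (a • m) = a • M.proj (k - i) m) ?_ ?_ ?_ m
  · intro l m hm
    by_cases h : k = i + l
    · subst h
      rw [proj_same (smul_mem_int ha hm), add_sub_cancel_left, proj_same hm]
    · rw [proj_ne h (smul_mem_int ha hm), proj_ne (fun h' => h (by rw [← h']; ring)) hm, smul_zero]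
  · simp
  · intro x y hx hy
    simp only [smul_add, map_add, hx, hy]

end

variable [GradedRing 𝒜] {M : GrMod 𝒜}

theorem proj_smul_of_mem_right {j : ℤ} {m : M} (hm : m ∈ M.grading j) (k : ℤ) (a : A) :
    M.proj k (a • m) = intComponent 𝒜 (k - j) a • m := by
  refine internal_induction (intGrading_isInternal 𝒜)
    (p := fun a => M.proj k (a • m) = intComponent 𝒜 (k - j) a • m) ?_ ?_ ?_ a
  · intro i a ha
    rw [proj_smul_of_mem ha]
    by_cases h : k = i + j
    · subst h
      rw [add_sub_cancel_left, add_sub_cancel_right, proj_same hm, intComponent,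
        internalProj_same _ _ _ ha]
    · rw [proj_ne (fun h' => h (by rw [← h']; ring)) hm, smul_zero, intComponent,
        internalProj_ne _ _ _ (fun h' => h (by rw [← h']; ring)) _ ha, zero_smul]
  · simp
  · intro x y hx hy
    simp only [add_smul, map_add, hx, hy]

open SetLike in
/-- The component of degree `k` as a module over the ring of elements of degree zero. -/
def component (M : GrMod 𝒜) (k : ℤ) : Submodule (GradeZero.subring 𝒜) M where
  carrier := M.grading k
  add_mem' := add_mem
  zero_mem' := zero_mem _
  smul_mem' a m hm := by
    have := M.smul_mem 0 k a m a.2 hm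
    rwa [Nat.cast_zero, zero_add] at this

theorem mem_component {k : ℤ} {m : M} : m ∈ M.component k ↔ m ∈ M.grading k := Iff.rfl

theorem component_fg_iff (k : ℤ) :
    (M.component k).FG ↔ IsFGOverDegreeZero 𝒜 (M.grading k) := by
  constructor
  · rintro ⟨s, hs⟩
    exact ⟨s, by rw [hs]; rfl⟩
  · rintro ⟨s, hs⟩
    refine ⟨s, SetLike.ext fun m => ?_⟩
    rw [mem_component, ← hs]
    rfl

/-- Nakayama's lemma for the image of `P` in `N ⧸ L`. Only `P` has to be finitely generated. -/
theorem _root_.Submodule.le_of_le_sup_jacobson_smul {R N : Type*} [Ring R] [AddCommGroup N]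
    [Module R N] {P L : Submodule R N} (hP : P.FG) (h : P ≤ L ⊔ Ring.jacobson R • P) : P ≤ L := by
  have h1 : P.map L.mkQ ≤ Ring.jacobson R • P.map L.mkQ := by
    refine (Submodule.map_mono h).trans ?_
    rw [Submodule.map_sup, Submodule.mkQ_map_self, bot_sup_eq, Submodule.map_smul'']
  have h2 := (hP.map L.mkQ).eq_bot_of_le_jacobson_smul h1
  intro x hx
  have h3 : L.mkQ x ∈ P.map L.mkQ := ⟨x, hx, rfl⟩
  rw [h2] at h3
  exact (Submodule.Quotient.mk_eq_zero _).1 h3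

/-- Nakayama's lemma for graded modules that are left finite and bounded below. -/
theorem eq_top_of_sup_radical_smul_eq_top (hM : M.IsLeftFinite) (hb : M.IsBoundedBelow)
    (L : Submodule A M) (hL : ∀ k, ∀ m ∈ L, M.proj k m ∈ L)
    (h : L ⊔ gradedRadical 𝒜 • ⊤ = ⊤) : L = ⊤ := by
  obtain ⟨b, hb⟩ := hb
  have step : ∀ k, (∀ j < k, ∀ m ∈ M.grading j, m ∈ L) → ∀ m ∈ M.grading k, m ∈ L := by
    intro k ih
    let R := SetLike.GradeZero.subring 𝒜
    let L₀ : Submodule R M := L.restrictScalars R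
    -- Expand an element of `J M` into terms `a • m` with `m` of degree `j`, and take components of
    -- degree `k`. Terms with `j > k` vanish because `A` has no negative degrees. Terms with `j = k`
    -- have coefficient in `J(A₀)`, and terms with `j < k` lie in `L` by induction.
    have key : M.component k ≤ L₀ ⊔ Ring.jacobson R • M.component k := by
      intro m hm
      have hm' : m ∈ L ⊔ gradedRadical 𝒜 • ⊤ := by rw [h]; trivial
      obtain ⟨l, hl, y, hy, rfl⟩ := Submodule.mem_sup.1 hm'
      rw [mem_component] at hm
      rw [← proj_same hm, map_add]
      refine add_mem (Submodule.mem_sup_left (hL k l hl)) ?_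
      refine Submodule.smul_induction_on (p := fun y => M.proj k y ∈ _) hy ?_ ?_
      · intro a ha m _
        refine internal_induction M.isInternal (p := fun m => M.proj k (a • m) ∈ _) ?_ ?_ ?_ m
        · intro j m hm
          rw [proj_smul_of_mem_right hm]
          rcases lt_trichotomy k j with hkj | rfl | hkj
          · rw [intGrading_eq_zero (sub_neg.2 hkj) (intComponent_mem _ a), zero_smul]
            exact zero_mem _
          · refine Submodule.mem_sup_right ?_
            have h0 : intComponent 𝒜 (k - k) a ∈ 𝒜 0 := by
              have := intComponent_mem (𝒜 := 𝒜) (k - k) a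
              rw [sub_self] at this ⊢
              exact this
            have hJ : intComponent 𝒜 (k - k) a ∈ gradedRadical 𝒜 :=
              gradedRadical_homogeneous 𝒜 _ a ha
            exact Submodule.smul_mem_smul (r := (⟨_, h0⟩ : R))
              ((coe_mem_gradedRadical_iff 𝒜 ⟨_, h0⟩).1 hJ) hm
          · exact Submodule.mem_sup_left (L.smul_mem _ (ih j hkj m hm))
        · rw [smul_zero, map_zero]; exact zero_mem _
        · intro x y hx hy
          rw [smul_add, map_add]
          exact add_mem hx hy
      · intro x y hx hy
        rw [map_add]; exact add_mem hx hy
    exact fun m hm => Submodule.le_of_le_sup_jacobson_smul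
      ((component_fg_iff k).2 (hM k)) key hm
  have all : ∀ n : ℕ, ∀ k < b + n, ∀ m ∈ M.grading k, m ∈ L := by
    intro n
    induction n with
    | zero =>
      intro k hk m hm
      rw [hb k (by simpa using hk)] at hm
      rw [(AddSubgroup.mem_bot).1 hm]; exact zero_mem _
    | succ n ih =>
      intro k hk
      refine step k fun j hj => ih j ?_
      push_cast at hk
      lia
  refine eq_top_iff.2 fun m _ => mem_of_proj_mem L.toAddSubgroup fun k => ?_
  exact all (k - b + 1).toNat k (by lia) _ (M.proj_mem k m)

end GrMod

namespace GrMod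

variable {A : Type u} [Ring A] {𝒜 : ℕ → AddSubgroup A}

/-! ### Free graded modules -/

section Free

variable [GradedRing 𝒜] {I : Type} (d : I → ℤ)

/-- The projection of `⨁ᵢ A(-dᵢ)` to its component of degree `k`. -/
noncomputable def freeProj (𝒜 : ℕ → AddSubgroup A) [GradedRing 𝒜] (k : ℤ) :
    (I →₀ A) →+ (I →₀ A) :=
  Finsupp.liftAddHom fun i => (Finsupp.singleAddHom i).comp (intComponent 𝒜 (k - d i))

theorem freeProj_apply (k : ℤ) (f : I →₀ A) (i : I) :
    freeProj d 𝒜 k f i = intComponent 𝒜 (k - d i) (f i) := by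
  classical
  induction f using Finsupp.induction_linear with
  | zero => simp
  | add f g hf hg => simp only [map_add, Finsupp.add_apply, hf, hg]
  | single j a =>
    by_cases h : j = i
    · subst h; simp [freeProj]
    · simp [freeProj, h]

/-- The free graded module `⨁ᵢ A(-dᵢ)`, with a basis of elements of degrees `dᵢ`. -/
noncomputable def free (𝒜 : ℕ → AddSubgroup A) [GradedRing 𝒜] : GrMod 𝒜 where
  carrier := I →₀ A
  grading k :=
    { carrier := {f | ∀ i, f i ∈ intGrading 𝒜 (k - d i)}
      add_mem' := fun hf hg i => add_mem (hf i) (hg i)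
      zero_mem' := fun _ => zero_mem _
      neg_mem' := fun hf i => neg_mem (hf i) }
  isInternal := by
    refine isInternal_of_proj (freeProj d 𝒜) ?_ ?_ ?_
    · intro k f hf
      ext i
      rw [freeProj_apply]
      exact internalProj_same _ _ _ (hf i)
    · intro k l hkl f hf
      ext i
      rw [freeProj_apply]
      exact internalProj_ne _ _ _ (fun h => hkl (sub_left_injective h)) _ (hf i)
    · intro f
      induction f using Finsupp.induction_linear with
      | zero => exact zero_mem _
      | add f g hf hg => exact add_mem hf hg
      | single j a =>
        refine internal_induction (intGrading_isInternal 𝒜) (p := fun a => Finsupp.single j a ∈ _)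
          ?_ ?_ ?_ a
        · intro l a ha
          refine AddSubgroup.mem_iSup_of_mem (l + d j) fun i => ?_
          classical
          rw [Finsupp.single_apply]
          split_ifs with h
          · rw [← h, add_sub_cancel_right]; exact ha
          · exact zero_mem _
        · rw [Finsupp.single_zero]; exact zero_mem _
        · intro x y hx hy
          rw [Finsupp.single_add]; exact add_mem hx hy
  smul_mem i k a f ha hf j := by
    have := (regular 𝒜).smul_mem i _ a _ ha (hf j)
    rwa [← add_sub_assoc] at this

theorem free_proj (k : ℤ) (f : I →₀ A) : (free d 𝒜).proj k f = freeProj d 𝒜 k f := by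
  refine internal_induction (free d 𝒜).isInternal
    (p := fun f => (free d 𝒜).proj k f = freeProj d 𝒜 k f) ?_ ?_ ?_ f
  · intro l f hf
    by_cases hkl : k = l
    · subst hkl
      exact (proj_same hf).trans (Finsupp.ext fun i => (internalProj_same _ _ _ (hf i)).symm.trans
        (freeProj_apply d k f i).symm)
    · exact (proj_ne hkl hf).trans (Finsupp.ext fun i => (internalProj_ne _ _ _
        (fun h => hkl (sub_left_injective h)) _ (hf i)).symm.trans (freeProj_apply d k f i).symm)
  · exact (map_zero _).trans (map_zero (freeProj d 𝒜 k)).symm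
  · intro x y hx hy
    rw [map_add, hx, hy]
    exact (map_add (freeProj d 𝒜 k) x y).symm

theorem single_mem_free_grading {k : ℤ} {i : I} {a : A} (ha : a ∈ intGrading 𝒜 (k - d i)) :
    Finsupp.single i a ∈ (free d 𝒜).grading k := by
  classical
  intro j
  rw [Finsupp.single_apply]
  split_ifs with h
  · rw [← h]; exact ha
  · exact zero_mem _

theorem regular_component_fg (hfin : IsLeftFiniteRing 𝒜) (k : ℤ) :
    ((regular 𝒜).component k).FG := by
  rw [component_fg_iff]
  rcases k with k | k
  · exact hfin k
  · exact ⟨∅, by simp; rfl⟩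

/-- In degree `k` only the basis elements of degree at most `k` contribute, since `A` vanishes in
negative degrees. -/
theorem free_isLeftFinite (hfin : IsLeftFiniteRing 𝒜) (hd : ∀ k, {i | d i ≤ k}.Finite) :
    (free d 𝒜).IsLeftFinite := by
  intro k
  rw [← component_fg_iff]
  let R := SetLike.GradeZero.subring 𝒜
  let ℓ (i : I) : (regular 𝒜) →ₗ[R] (free d 𝒜) :=
    LinearMap.restrictScalars R (show (regular 𝒜) →ₗ[A] (free d 𝒜) from
      (Finsupp.lsingle i : A →ₗ[A] I →₀ A))
  have hle : (free d 𝒜).component k = ⨆ i ∈ (hd k).toFinset,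
      ((regular 𝒜).component (k - d i)).map (ℓ i) := by
    apply le_antisymm
    · intro (f : I →₀ A) (hf : ∀ i, f i ∈ intGrading 𝒜 (k - d i))
      have hsupp : ∀ i, f i ≠ 0 → d i ≤ k := fun i hi => by
        by_contra hlt
        exact hi (intGrading_eq_zero (by lia) (hf i))
      rw [← Finsupp.sum_single f]
      refine sum_mem fun i hi => ?_
      have hi' : i ∈ (hd k).toFinset := by
        simpa using hsupp i (Finsupp.mem_support_iff.1 hi)
      exact Submodule.mem_iSup_of_mem i (Submodule.mem_iSup_of_mem hi' ⟨f i, hf i, rfl⟩)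
    · refine iSup₂_le fun i _ => ?_
      rintro _ ⟨(a : A), ha, rfl⟩
      exact single_mem_free_grading d ha
  rw [hle]
  exact Submodule.fg_biSup _ _ fun i _ => (regular_component_fg hfin _).map _

end Free

/-! ### Submodules of finite modules -/

section Sub

theorem IsBoundedBelow.sub {M : GrMod 𝒜} (hM : M.IsBoundedBelow) (N : Submodule A M)
    (hN : ∀ k, ∀ m ∈ N, M.proj k m ∈ N) : (M.sub N hN).IsBoundedBelow := by
  obtain ⟨b, hb⟩ := hM
  refine ⟨b, fun k hk => (AddSubgroup.eq_bot_iff_forall _).2 fun x hx => Subtype.ext ?_⟩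
  have : N.subtype x ∈ M.grading k := hx
  rw [hb k hk] at this
  exact (AddSubgroup.mem_bot).1 this

/-- This is where `A₀` noetherian enters: it lets the construction of projective covers be repeated
on kernels. -/
theorem IsLeftFinite.sub [GradedRing 𝒜] (hnoeth : IsNoetherianRing (𝒜 0)) {M : GrMod 𝒜}
    (hM : M.IsLeftFinite) (N : Submodule A M) (hN : ∀ k, ∀ m ∈ N, M.proj k m ∈ N) :
    (M.sub N hN).IsLeftFinite := by
  intro k
  rw [← component_fg_iff]
  let R := SetLike.GradeZero.subring 𝒜
  have hR : IsNoetherianRing R := hnoeth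
  let g : (M.sub N hN) →ₗ[R] M := N.subtype.restrictScalars R
  have hg : Function.Injective g := Subtype.val_injective
  refine Submodule.fg_of_fg_map_injective g hg ?_
  refine Submodule.FG.of_le ((component_fg_iff k).2 (hM k)) ?_
  rintro _ ⟨x, hx, rfl⟩
  exact hx

end Sub

/-! ### Dual bases -/

section DualBasis

/-- A homogeneous dual basis of `P` with finitely many elements in degrees `≤ k` for every `k`. -/
structure DualBasis (P : GrMod 𝒜) where
  I : Type
  d : I → ℤ
  finite : ∀ k, {i | d i ≤ k}.Finite
  v : I → P
  v_mem : ∀ i, v i ∈ P.grading (d i)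
  coord : P →ₗ[A] (I →₀ A)
  coord_mem : ∀ k, ∀ x ∈ P.grading k, ∀ i, coord x i ∈ intGrading 𝒜 (k - d i)
  sum_coord : ∀ x, Finsupp.linearCombination A v (coord x) = x

variable {P : GrMod 𝒜}

/-- The images of the `v i` lift to homogeneous elements of the same degrees. The coordinates then
extend this choice to a degree-preserving linear lift. -/
theorem DualBasis.projective (B : DualBasis P) : Projective P := by
  refine ⟨fun {E X} f e he => ?_⟩
  choose m hm hfm using fun i =>
    exists_mem_of_surjective e (surjective_of_epi e) (B.d i) _ (lin_mem f _ _ (B.v_mem i))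
  refine ⟨ofLin (Finsupp.linearCombination A m ∘ₗ B.coord) ?_, ?_⟩
  · intro k x hx
    rw [LinearMap.comp_apply, Finsupp.linearCombination_apply]
    refine sum_mem fun i _ => ?_
    have := smul_mem_int (B.coord_mem k x hx i) (hm i)
    rwa [sub_add_cancel] at this
  · refine hom_ext fun x => ?_
    conv_rhs => rw [← B.sum_coord x]
    simp only [lin_comp, lin_ofLin, LinearMap.comp_apply, Finsupp.linearCombination_apply]
    rw [map_finsuppSum, map_finsuppSum]
    simp only [map_smul, hfm]

theorem DualBasis.coord_mem_radical [GradedRing 𝒜] (B : DualBasis P) {x : P}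
    (hx : x ∈ gradedRadical 𝒜 • (⊤ : Submodule A P)) (i : B.I) :
    B.coord x i ∈ gradedRadical 𝒜 := by
  refine Submodule.smul_induction_on hx ?_ ?_
  · intro a ha y _
    rw [map_smul, Finsupp.smul_apply]
    exact (gradedRadical 𝒜).mul_mem_right _ ha
  · intro x y hx hy
    rw [map_add, Finsupp.add_apply]
    exact add_mem hx hy

end DualBasis

end GrMod

namespace GrMod

variable {A : Type u} [Ring A] {𝒜 : ℕ → AddSubgroup A} [GradedRing 𝒜]

/-! ### Projective covers -/

/-- Homogeneous elements `mᵢ` of degree `k` and idempotents `eᵢ` of degree zero with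
`(M / J M)ₖ = ⨁ᵢ (A / J) eᵢ mᵢ`. -/
theorem exists_component_generators (hsemi : IsSemiperfectRing (𝒜 0)) {M : GrMod 𝒜}
    (hM : M.IsLeftFinite) (k : ℤ) :
    ∃ (r : ℕ) (m : Fin r → M) (e : Fin r → A), (∀ i, e i ∈ 𝒜 0) ∧ (∀ i, e i * e i = e i) ∧
      (∀ i, m i ∈ M.grading k) ∧ (∀ i, e i • m i = m i) ∧
      (∀ x ∈ M.grading k, ∃ c : Fin r → A,
        x - ∑ i, c i • m i ∈ gradedRadical 𝒜 • (⊤ : Submodule A M)) ∧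
      ∀ c : Fin r → A, ∑ i, c i • m i ∈ gradedRadical 𝒜 • (⊤ : Submodule A M) →
        ∀ i, c i * e i ∈ gradedRadical 𝒜 := by
  have hss := isSemisimpleRing_quotient_gradedRadical hsemi
  set JM : Submodule A M := gradedRadical 𝒜 • ⊤ with hJM
  have hJq : ∀ a ∈ gradedRadical 𝒜, ∀ w : M ⧸ JM, a • w = 0 := by
    rintro a ha w
    obtain ⟨x, rfl⟩ := JM.mkQ_surjective w
    exact (Submodule.Quotient.mk_eq_zero _).2 (Submodule.smul_mem_smul ha trivial)
  -- `A` acts on `M / J M` through its component of degree zero, so the image of a single `M.grading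
  -- k` is already an `A`-submodule.
  have hzero : ∀ (a : A) (x : M), JM.mkQ (a • x) =
      JM.mkQ ((GradedRing.projZeroRingHom' 𝒜 a : A) • x) := by
    intro a x
    rw [← sub_eq_zero, ← map_sub, ← sub_smul, map_smul]
    exact hJq _ (sub_projZero_mem_gradedRadical 𝒜 a) _
  let W : Submodule A (M ⧸ JM) :=
    { carrier := JM.mkQ '' (M.grading k)
      add_mem' := by
        rintro _ _ ⟨x, hx, rfl⟩ ⟨y, hy, rfl⟩
        exact ⟨x + y, add_mem hx hy, map_add _ _ _⟩
      zero_mem' := ⟨0, zero_mem _, map_zero _⟩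
      smul_mem' := by
        rintro a _ ⟨x, hx, rfl⟩
        refine ⟨(GradedRing.projZeroRingHom' 𝒜 a : A) • x, ?_, ?_⟩
        · exact (M.component k).smul_mem (GradedRing.projZeroRingHom' 𝒜 a) hx
        · rw [← hzero, map_smul] }
  have hWfg : W.FG := by
    obtain ⟨s, hs⟩ := (component_fg_iff k).2 (hM k)
    classical
    refine ⟨s.image JM.mkQ, le_antisymm ?_ ?_⟩
    · rw [Submodule.span_le]
      intro w hw
      obtain ⟨x, hx, rfl⟩ := Finset.mem_image.1 (Finset.mem_coe.1 hw)
      refine ⟨x, ?_, rfl⟩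
      have : x ∈ M.component k := by rw [← hs]; exact Submodule.subset_span hx
      exact this
    · rintro _ ⟨x, hx, rfl⟩
      have hx' : x ∈ M.component k := hx
      rw [← hs] at hx'
      refine Submodule.span_induction (p := fun x _ => JM.mkQ x ∈ _) ?_ ?_ ?_ ?_ hx'
      · intro y hy
        exact Submodule.subset_span (by simpa using ⟨y, hy, rfl⟩)
      · rw [map_zero]; exact zero_mem _
      · intro y z _ _ hy hz
        rw [map_add]; exact add_mem hy hz
      · intro a y _ hy
        exact Submodule.smul_mem _ (a : A) hy
  have : Module.Finite A W := Module.Finite.iff_fg.2 hWfg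
  obtain ⟨r, w, f, hf1, hf2, hgen, hind⟩ := exists_idempotent_decomposition (gradedRadical 𝒜)
    (W := W) (fun a ha w => Subtype.ext (hJq a ha w))
  choose e he0 hee hef using fun i => exists_idempotent_lift hsemi (f i) (hf1 i)
  choose m hm hmw using fun i => (w i).2
  -- Replacing `m i` by `e i • m i` makes it fixed by `e i`. Its class is unchanged, because `e i ≡
  -- f i` modulo `J` and `f i` fixes `w i`.
  have hew : ∀ i, JM.mkQ (e i • m i) = w i := by
    intro i
    have h1 := hJq _ (hef i) (JM.mkQ (m i))
    rw [sub_smul, sub_eq_zero] at h1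
    rw [map_smul, h1, hmw]
    exact congrArg Subtype.val (hf2 i)
  have hsum : ∀ c : Fin r → A, JM.mkQ (∑ i, c i • e i • m i) = (∑ i, c i • w i : W) := by
    intro c
    rw [map_sum, AddSubmonoidClass.coe_finsetSum]
    refine Finset.sum_congr rfl fun i _ => ?_
    rw [map_smul, hew]; rfl
  refine ⟨r, fun i => e i • m i, e, he0, hee, fun i => ?_, fun i => ?_, fun x hx => ?_,
    fun c hc i => ?_⟩
  · exact (M.component k).smul_mem ⟨e i, he0 i⟩ (hm i)
  · rw [← mul_smul, hee]
  · obtain ⟨c, hc⟩ := hgen ⟨JM.mkQ x, x, hx, rfl⟩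
    refine ⟨c, ?_⟩
    rw [← Submodule.Quotient.eq JM]
    exact (congrArg Subtype.val hc).symm.trans (hsum c).symm
  · have h0 : ∑ i, c i • w i = 0 := by
      apply Subtype.ext
      rw [← hsum]
      exact (Submodule.Quotient.mk_eq_zero _).2 hc
    have h1 : c i * (e i - f i) ∈ gradedRadical 𝒜 := (gradedRadical 𝒜).mul_mem_left _ (hef i)
    rw [mul_sub] at h1
    exact (Submodule.sub_mem_iff_left _ (hind c h0 i)).1 h1

section Idempotent

variable {I : Type} (d : I → ℤ) (e : I → A)

/-- The submodule `⨁ᵢ A eᵢ` of `⨁ᵢ A`. -/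
def idempotentSubmodule : Submodule A (I →₀ A) where
  carrier := {f | ∀ i, f i * e i = f i}
  add_mem' := fun hf hg i => by rw [Finsupp.add_apply, add_mul, hf i, hg i]
  zero_mem' := fun i => by simp
  smul_mem' := fun a f hf i => by rw [Finsupp.smul_apply, smul_eq_mul, mul_assoc, hf i]

/-- Right multiplication by an element of degree zero commutes with the projections to components.
-/
theorem idempotentSubmodule_homogeneous (he : ∀ i, e i ∈ 𝒜 0) (k : ℤ) (f : I →₀ A)
    (hf : f ∈ idempotentSubmodule e) : (free d 𝒜).proj k f ∈ idempotentSubmodule e := by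
  rw [free_proj]
  intro i
  rw [freeProj_apply]
  have h := proj_smul_of_mem_right (M := regular 𝒜) (j := 0) (m := e i) (he i) (k - d i) (f i)
  rw [sub_zero] at h
  refine h.symm.trans ?_
  exact congrArg (intComponent 𝒜 (k - d i)) (hf i)

/-- The graded module `⨁ᵢ A eᵢ(-dᵢ)` for idempotents `eᵢ` of degree zero. -/
noncomputable def idempotentSum (he : ∀ i, e i ∈ 𝒜 0) : GrMod 𝒜 :=
  (free d 𝒜).sub (idempotentSubmodule e) (idempotentSubmodule_homogeneous d e he)

variable {e}

theorem single_mem_idempotentSubmodule (hee : ∀ i, e i * e i = e i) (i : I) :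
    Finsupp.single i (e i) ∈ idempotentSubmodule e := by
  classical
  intro j
  rw [Finsupp.single_apply]
  split_ifs with h
  · rw [← h, hee]
  · rw [zero_mul]

theorem sum_single_idempotent {f : I →₀ A} (hf : f ∈ idempotentSubmodule e) :
    (f.sum fun i a => a • Finsupp.single i (e i)) = f := by
  conv_rhs => rw [← Finsupp.sum_single f]
  refine Finset.sum_congr rfl fun i _ => ?_
  change f i • Finsupp.single i (e i) = Finsupp.single i (f i)
  rw [Finsupp.smul_single, smul_eq_mul, hf i]

theorem linearCombination_single_idempotent (hee : ∀ i, e i * e i = e i)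
    (x : idempotentSubmodule e) :
    Finsupp.linearCombination A (fun i => (⟨Finsupp.single i (e i),
      single_mem_idempotentSubmodule hee i⟩ : idempotentSubmodule e)) (x : I →₀ A) = x := by
  refine Subtype.ext ?_
  rw [Finsupp.linearCombination_apply]
  have h := map_finsuppSum (idempotentSubmodule e).subtype (x : I →₀ A)
    (fun i a => a • (⟨Finsupp.single i (e i), single_mem_idempotentSubmodule hee i⟩ :
      idempotentSubmodule e))
  exact h.trans (sum_single_idempotent x.2)

/-- The dual basis of `⨁ᵢ A eᵢ(-dᵢ)` given by the elements `eᵢ`. -/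
noncomputable def idempotentSumDualBasis (he : ∀ i, e i ∈ 𝒜 0) (hee : ∀ i, e i * e i = e i)
    (hd : ∀ k, {i | d i ≤ k}.Finite) : DualBasis (idempotentSum d e he) where
  I := I
  d := d
  finite := hd
  v i := (⟨Finsupp.single i (e i), single_mem_idempotentSubmodule hee i⟩ : idempotentSubmodule e)
  v_mem i := single_mem_free_grading d (by rw [sub_self]; exact he i)
  coord := (idempotentSubmodule e).subtype
  coord_mem _ _ hx i := hx i
  sum_coord x := linearCombination_single_idempotent hee x

end Idempotent

/-- A left finite graded module that is bounded below has a projective cover with a locally finite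
dual basis. -/
theorem exists_projectiveCover (hfin : IsLeftFiniteRing 𝒜) (hnoeth : IsNoetherianRing (𝒜 0))
    (hsemi : IsSemiperfectRing (𝒜 0)) {M : GrMod 𝒜} (hM : M.IsLeftFinite) (hb : M.IsBoundedBelow) :
    ∃ (P : GrMod 𝒜) (π : P ⟶ M), Nonempty (DualBasis P) ∧ P.IsLeftFinite ∧ P.IsBoundedBelow ∧
      Function.Surjective (lin π) ∧
      LinearMap.ker (lin π) ≤ gradedRadical 𝒜 • (⊤ : Submodule A P) := by
  obtain ⟨b, hb'⟩ := hb
  choose r m e he0 hee hm hem hgen hind using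
    fun n : ℕ => exists_component_generators hsemi hM (b + n)
  let I : Type := Σ n : ℕ, Fin (r n)
  let d : I → ℤ := fun i => b + i.1
  let E : I → A := fun i => e i.1 i.2
  let μ : I → M := fun i => m i.1 i.2
  have hE0 : ∀ i, E i ∈ 𝒜 0 := fun i => he0 _ _
  have hEE : ∀ i, E i * E i = E i := fun i => hee _ _
  have hd : ∀ k, {i | d i ≤ k}.Finite := fun k =>
    ((Finset.range (k - b + 1).toNat).sigma fun _ => Finset.univ).finite_toSet.subset
      fun i (hi : b + i.1 ≤ k) => by
        simp only [Finset.coe_sigma, Set.mem_sigma_iff, Finset.coe_range, Set.mem_Iio,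
          Finset.coe_univ, Set.mem_univ, and_true]
        lia
  let P := idempotentSum d E hE0
  let τ : (I →₀ A) →ₗ[A] M := Finsupp.linearCombination A μ
  have hτ : ∀ f : I →₀ A, τ f = f.sum fun i a => a • μ i := fun f => rfl
  have hτmem : ∀ (k : ℤ) (f : I →₀ A), (∀ i, f i ∈ intGrading 𝒜 (k - d i)) →
      τ f ∈ M.grading k := fun k f hf => by
    rw [hτ]
    refine sum_mem fun i _ => ?_
    have := smul_mem_int (hf i) (hm i.1 i.2)
    rwa [sub_add_cancel] at this
  let τ' : free d 𝒜 ⟶ M := ofLin (M := free d 𝒜) τ hτmem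
  let π : P ⟶ M := ofLin (M := P) (τ ∘ₗ (idempotentSubmodule E).subtype)
    fun k f hf => hτmem k _ hf
  have hπμ : ∀ i (a : A), a • μ i ∈ LinearMap.range (lin π) := by
    intro i a
    refine Submodule.smul_mem _ a ⟨(⟨Finsupp.single i (E i),
      single_mem_idempotentSubmodule hEE i⟩ : idempotentSubmodule E), ?_⟩
    change τ (Finsupp.single i (E i)) = _
    rw [Finsupp.linearCombination_single]
    exact hem _ _
  refine ⟨P, π, ⟨idempotentSumDualBasis d hE0 hEE hd⟩,
    (free_isLeftFinite d hfin hd).sub hnoeth _ _, ?_, ?_, ?_⟩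
  · refine IsBoundedBelow.sub ⟨b, fun k hk => (AddSubgroup.eq_bot_iff_forall _).2 fun f hf => ?_⟩ _ _
    refine Finsupp.ext fun i => intGrading_eq_zero ?_ (hf i)
    change k - (b + i.1) < 0
    lia
  · rw [← LinearMap.range_eq_top]
    refine eq_top_of_sup_radical_smul_eq_top hM ⟨b, hb'⟩ _ (range_homogeneous π) ?_
    refine eq_top_iff.2 fun x _ => mem_of_proj_mem
      (LinearMap.range (lin π) ⊔ gradedRadical 𝒜 • ⊤).toAddSubgroup fun k => ?_
    by_cases hk : k < b
    · have : M.proj k x = 0 := by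
        have := M.proj_mem k x
        rwa [hb' k hk, AddSubgroup.mem_bot] at this
      rw [this]; exact zero_mem _
    · obtain ⟨n, rfl⟩ : ∃ n : ℕ, k = b + n := ⟨(k - b).toNat, by lia⟩
      obtain ⟨c, hc⟩ := hgen n _ (M.proj_mem _ x)
      rw [← add_sub_cancel (∑ i, c i • m n i) (M.proj (b + n) x)]
      exact add_mem (Submodule.mem_sup_left (sum_mem fun i _ => hπμ ⟨n, i⟩ (c i)))
        (Submodule.mem_sup_right hc)
  · intro (x : idempotentSubmodule E) (hx : τ x = 0)
    have hcoord : ∀ i, (x : I →₀ A) i ∈ gradedRadical 𝒜 := by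
      rintro ⟨n, i⟩
      refine mem_gradedRadical_of_components fun k => ?_
      by_cases hk : k = 0
      swap
      · exact mem_gradedRadical_of_mem_intGrading hk (intComponent_mem _ _)
      subst hk
      classical
      -- The degree-zero part of the coordinate at `(n, i)` of `x` is the coordinate at `(n, i)` of
      -- the homogeneous part `y` of degree `b + n`.
      set y : I →₀ A := freeProj d 𝒜 (b + n) x with hy
      have hτy : τ y = 0 := by
        have h := lin_proj τ' (b + n) (x : I →₀ A)
        rw [free_proj] at h
        refine h.trans ?_
        change M.proj (b + n) (τ x) = 0
        rw [hx, map_zero]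
      let T : Finset I := Finset.univ.map (Function.Embedding.sigmaMk n)
      -- Split the relation `τ y = 0` into the generators of degree `b + n` and the others. The
      -- coefficients of the others have nonzero degree, hence lie in `J`, so the independence of
      -- the first group modulo `J M` applies.
      have hsum : ∑ j, y ⟨n, j⟩ • m n j = -∑ j ∈ (y.support ∪ T) \ T, y j • μ j := by
        rw [eq_neg_iff_add_eq_zero, ← hτy, hτ,
          Finsupp.sum_of_support_subset y (Finset.subset_union_left : y.support ⊆ y.support ∪ T)
            (fun i a => a • μ i) (fun _ _ => zero_smul _ _),
          ← Finset.sum_sdiff (Finset.subset_union_right : T ⊆ y.support ∪ T), add_comm,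
          Finset.sum_map]
        rfl
      have hmem : ∑ j, y ⟨n, j⟩ • m n j ∈ gradedRadical 𝒜 • (⊤ : Submodule A M) := by
        rw [hsum]
        refine neg_mem (sum_mem fun j hj => Submodule.smul_mem_smul ?_ trivial)
        rw [hy, freeProj_apply]
        refine mem_gradedRadical_of_mem_intGrading (fun h => (Finset.mem_sdiff.1 hj).2 ?_)
          (intComponent_mem _ _)
        obtain ⟨n', j⟩ := j
        have hn : n' = n := by
          change b + (n : ℤ) - (b + n') = 0 at h
          lia
        subst hn
        exact Finset.mem_map_of_mem _ (Finset.mem_univ j)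
      have h1 := hind n _ hmem i
      have h2 : y ⟨n, i⟩ * e n i = y ⟨n, i⟩ := by
        have := idempotentSubmodule_homogeneous d E hE0 (b + n) x x.2
        rw [free_proj] at this
        exact this ⟨n, i⟩
      rw [h2, hy, freeProj_apply] at h1
      change intComponent 𝒜 (b + n - (b + n)) _ ∈ _ at h1
      rwa [sub_self] at h1
    have hx' := linearCombination_single_idempotent hEE x
    rw [← hx', Finsupp.linearCombination_apply]
    exact sum_mem fun i _ => Submodule.smul_mem_smul (hcoord i) trivial

end GrMod

namespace GrMod

variable {A : Type u} [Ring A] {𝒜 : ℕ → AddSubgroup A}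

/-! ### Minimal resolutions -/

/-- Left finiteness and boundedness below pass from a module to its projective cover and to the
kernel of the cover. Covers can therefore be iterated and spliced, and minimality is the kernel
bound of each cover. -/
theorem exists_minimal_resolution [GradedRing 𝒜] (hfin : IsLeftFiniteRing 𝒜)
    (hnoeth : IsNoetherianRing (𝒜 0)) (hsemi : IsSemiperfectRing (𝒜 0))
    {M : GrMod 𝒜} (hM : M.IsLeftFinite) (hb : M.IsBoundedBelow) :
    ∃ R : GrProjRes M, R.IsMinimal ∧ ∀ n, Nonempty (DualBasis (R.P n)) := by
  let Nice := {N : GrMod 𝒜 // N.IsLeftFinite ∧ N.IsBoundedBelow}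
  choose P π hB hPf hPb hsurj hker using
    fun N : Nice => exists_projectiveCover hfin hnoeth hsemi N.2.1 N.2.2
  let Ω : Nice → Nice := fun N =>
    ⟨(P N).sub (LinearMap.ker (lin (π N))) (ker_homogeneous (π N)),
      (hPf N).sub hnoeth _ _, (hPb N).sub _ _⟩
  let N : ℕ → Nice := fun n => Nat.rec ⟨M, hM, hb⟩ (fun _ X => Ω X) n
  let ι : ∀ n, (N (n + 1)).1 ⟶ P (N n) := fun n =>
    (P (N n)).subι (LinearMap.ker (lin (π (N n)))) (ker_homogeneous (π (N n)))
  have hι : ∀ n, Function.Injective (lin (ι n)) := fun n => Subtype.val_injective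
  have hrange : ∀ n, LinearMap.range (lin (π (N (n + 1)) ≫ ι n)) =
      LinearMap.ker (lin (π (N n))) := fun n => by
    rw [lin_comp, LinearMap.range_comp, LinearMap.range_eq_top.2 (hsurj _), Submodule.map_top]
    exact Submodule.range_subtype _
  have hkerι : ∀ n, LinearMap.ker (lin (π (N (n + 1)) ≫ ι n)) =
      LinearMap.ker (lin (π (N (n + 1)))) := fun n => by
    rw [lin_comp, LinearMap.ker_comp, LinearMap.ker_eq_bot.2 (hι n)]
    rfl
  refine ⟨{
    P := fun n => P (N n)
    projective := fun n => (hB (N n)).some.projective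
    ε := π (N 0)
    d := fun n => π (N (n + 1)) ≫ ι n
    ε_surjective := hsurj (N 0)
    exact_zero := hrange 0
    exact_succ := fun n => (hrange (n + 1)).trans (hkerι n).symm }, ?_, fun n => hB (N n)⟩
  intro n
  exact (hrange n).le.trans (hker (N n))

/-! ### Syzygies and their short exact sequences -/

section Syzygies

/-- The short complex of a surjective morphism and its kernel is short exact. -/
theorem shortExact_of_ker {P X : GrMod 𝒜} (f : P ⟶ X) (hf : Function.Surjective (lin f))
    (N : Submodule A P) (hN : ∀ k, ∀ m ∈ N, P.proj k m ∈ N) (h : N = LinearMap.ker (lin f))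
    (w : P.subι N hN ≫ f = 0) : (ShortComplex.mk (P.subι N hN) f w).ShortExact := by
  subst h
  have hepi : Epi f := ⟨fun g g' hg => hom_ext fun x => by
    obtain ⟨y, rfl⟩ := hf x
    exact LinearMap.congr_fun (congrArg lin hg) y⟩
  have hmono : Mono (P.subι _ hN) := ⟨fun g g' hg => hom_ext fun x =>
    Subtype.ext (LinearMap.congr_fun (congrArg lin hg) x)⟩
  exact { exact := ShortComplex.exact_of_f_is_kernel _ (kernelIsLimit f) }

namespace GrProjRes

variable {M : GrMod 𝒜} (R : GrProjRes M)

theorem kerD_homogeneous (n : ℕ) (k : ℤ) (m : R.P n) (hm : m ∈ R.kerD n) :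
    (R.P n).proj k m ∈ R.kerD n := by
  cases n with
  | zero => exact ker_homogeneous R.ε k m hm
  | succ n => exact ker_homogeneous (R.d n) k m hm

theorem range_d (n : ℕ) : LinearMap.range (lin (R.d n)) = R.kerD n := by
  cases n with
  | zero => exact R.exact_zero
  | succ n => exact R.exact_succ n

/-- The syzygies of the resolution. -/
noncomputable def syz : ℕ → GrMod 𝒜
  | 0 => M
  | n + 1 => (R.P n).sub (R.kerD n) (R.kerD_homogeneous n)

/-- The projection `Pₙ → Ωⁿ M`. -/
noncomputable def cover : (n : ℕ) → (R.P n ⟶ R.syz n)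
  | 0 => R.ε
  | n + 1 => ofLin (N := R.syz (n + 1)) (LinearMap.codRestrict (R.kerD n) (lin (R.d n))
      fun x => by rw [← R.range_d]; exact ⟨x, rfl⟩) (fun k m hm => lin_mem (R.d n) k m hm)

theorem cover_surjective (n : ℕ) : Function.Surjective (lin (R.cover n)) := by
  cases n with
  | zero => exact R.ε_surjective
  | succ n =>
    rintro ⟨x, hx⟩
    rw [← R.range_d] at hx
    obtain ⟨y, hy⟩ := hx
    exact ⟨y, Subtype.ext hy⟩

theorem ker_cover (n : ℕ) : R.kerD n = LinearMap.ker (lin (R.cover n)) := by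
  cases n with
  | zero => rfl
  | succ n => exact (LinearMap.ker_codRestrict _ _ _).symm

/-- The inclusion `Ωⁿ⁺¹ M → Pₙ`. -/
noncomputable def incl (n : ℕ) : R.syz (n + 1) ⟶ R.P n :=
  (R.P n).subι (R.kerD n) (R.kerD_homogeneous n)

theorem incl_cover (n : ℕ) : R.incl n ≫ R.cover n = 0 := hom_ext fun m =>
  (R.ker_cover n).le (show (R.kerD n).subtype m ∈ R.kerD n from m.2)

/-- The short complex `Ωⁿ⁺¹ M → Pₙ → Ωⁿ M`. -/
noncomputable def ses (n : ℕ) : ShortComplex (GrMod 𝒜) :=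
  ShortComplex.mk (R.incl n) (R.cover n) (R.incl_cover n)

theorem ses_shortExact (n : ℕ) : (R.ses n).ShortExact :=
  shortExact_of_ker (R.cover n) (R.cover_surjective n) _ _ (R.ker_cover n) (R.incl_cover n)

theorem IsMinimal.kerD_le [GradedRing 𝒜] {R : GrProjRes M} (hR : R.IsMinimal) (n : ℕ) :
    R.kerD n ≤ gradedRadical 𝒜 • (⊤ : Submodule A (R.P n)) := by
  rw [← R.range_d]; exact hR n

end GrProjRes

end Syzygies

/-! ### Maps to shifts of `S` -/

section SimpleTop

variable [GradedRing 𝒜]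

/-- All positive degrees of `A` lie in `J`, so `S` is concentrated in degree zero. -/
theorem mem_simpleTop_grading_zero (x : simpleTop 𝒜) : x ∈ (simpleTop 𝒜).grading 0 := by
  obtain ⟨a, rfl⟩ := (gradedRadical 𝒜).mkQ_surjective x
  refine ⟨(GradedRing.projZeroRingHom' 𝒜 a : A), SetLike.coe_mem _, ?_⟩
  refine ((Submodule.Quotient.eq _).2 ?_).symm
  exact sub_projZero_mem_gradedRadical 𝒜 a

theorem radical_smul_simpleTop {a : A} (ha : a ∈ gradedRadical 𝒜) (x : simpleTop 𝒜) :
    a • x = 0 := by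
  obtain ⟨b, rfl⟩ := (gradedRadical 𝒜).mkQ_surjective x
  exact (Submodule.Quotient.mk_eq_zero _).2 ((gradedRadical 𝒜).mul_mem_right b ha)

/-- Linear maps to `S` vanish on `J N`. -/
theorem linearMap_simpleTop_eq_zero {N : Type*} [AddCommGroup N] [Module A N]
    (φ : N →ₗ[A] simpleTop 𝒜) {x : N} (hx : x ∈ gradedRadical 𝒜 • (⊤ : Submodule A N)) :
    φ x = 0 := by
  refine Submodule.smul_induction_on (p := fun x => φ x = 0) hx ?_ ?_
  · intro a ha y _
    rw [map_smul, radical_smul_simpleTop ha]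
  · intro x y hx hy
    rw [map_add, hx, hy, add_zero]

/-- A morphism to `S(l)` as a linear map to `S`. -/
noncomputable def toSimpleTop {N : GrMod 𝒜} {l : ℤ} (u : N ⟶ (shiftFunctor 𝒜 l).obj (simpleTop 𝒜)) :
    N →ₗ[A] simpleTop 𝒜 :=
  lin (N := (simpleTop 𝒜).shift l) u

/-- The graded part of degree `l` of a linear map to `S`. -/
noncomputable def gradedPart {N : GrMod 𝒜} (φ : N →ₗ[A] simpleTop 𝒜) (l : ℤ) :
    N ⟶ (shiftFunctor 𝒜 l).obj (simpleTop 𝒜) :=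
  ofLin (N := (simpleTop 𝒜).shift l)
    { toFun := fun x => φ (N.proj (-l) x)
      map_add' := fun x y => by rw [map_add, map_add]; rfl
      -- The projection alone is not `A`-linear, but its failure comes from coefficients of nonzero
      -- degree. These lie in `J` and act as zero on `S`.
      map_smul' := fun a x => by
        refine internal_induction (intGrading_isInternal 𝒜)
          (p := fun a => φ (N.proj (-l) (a • x)) = a • φ (N.proj (-l) x)) ?_ ?_ ?_ a
        · intro i a ha
          rw [proj_smul_of_mem ha, map_smul]
          by_cases hi : i = 0
          · subst hi; rw [sub_zero]
          · have := mem_gradedRadical_of_mem_intGrading hi ha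
            rw [radical_smul_simpleTop this, radical_smul_simpleTop this]
        · simp
        · intro a b ha hb
          rw [add_smul, add_smul, map_add, map_add, ha, hb] }
    (fun k x hx => by
      change φ (N.proj (-l) x) ∈ (simpleTop 𝒜).grading (k + l)
      by_cases h : k + l = 0
      · rw [h]; exact mem_simpleTop_grading_zero _
      · rw [proj_ne (fun h' => h (by rw [← h']; ring)) hx, map_zero]
        exact zero_mem _)

theorem gradedPart_apply {N : GrMod 𝒜} (φ : N →ₗ[A] simpleTop 𝒜) (l : ℤ) (x : N) :
    toSimpleTop (gradedPart φ l) x = φ (N.proj (-l) x) := rfl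

theorem toSimpleTop_proj {N : GrMod 𝒜} {l : ℤ}
    (u : N ⟶ (shiftFunctor 𝒜 l).obj (simpleTop 𝒜)) (x : N) :
    toSimpleTop u (N.proj (-l) x) = toSimpleTop u x := by
  refine (lin_proj (N := (simpleTop 𝒜).shift l) u (-l) x).trans (proj_same (M := (simpleTop 𝒜).shift l) ?_)
  change _ ∈ (simpleTop 𝒜).grading (-l + l)
  rw [neg_add_cancel]
  exact mem_simpleTop_grading_zero _

/-- Morphisms to the shifts of `S` detect the elements outside of `J N`. -/
theorem exists_toSimpleTop_ne_zero (hsemi : IsSemiperfectRing (𝒜 0)) {N : GrMod 𝒜} {x : N}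
    (hx : x ∉ gradedRadical 𝒜 • (⊤ : Submodule A N)) :
    ∃ (l : ℤ) (u : N ⟶ (shiftFunctor 𝒜 l).obj (simpleTop 𝒜)), toSimpleTop u x ≠ 0 := by
  have hss := isSemisimpleRing_quotient_gradedRadical hsemi
  -- Some homogeneous component of `x` is outside `J N`. Its degree `k` determines the shift `-k`.
  obtain ⟨k, hk⟩ : ∃ k, N.proj k x ∉ gradedRadical 𝒜 • (⊤ : Submodule A N) := by
    by_contra! h
    exact hx (mem_of_proj_mem (gradedRadical 𝒜 • (⊤ : Submodule A N)).toAddSubgroup h)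
  set JN : Submodule A N := gradedRadical 𝒜 • ⊤
  obtain ⟨φ, hφ⟩ := exists_linearMap_apply_ne_zero (gradedRadical 𝒜) (W := N ⧸ JN) (by
    rintro a ha w
    obtain ⟨y, rfl⟩ := JN.mkQ_surjective w
    exact (Submodule.Quotient.mk_eq_zero _).2 (Submodule.smul_mem_smul ha trivial))
    (JN.mkQ (N.proj k x)) (fun h => hk ((Submodule.Quotient.mk_eq_zero _).1 h))
  let ψ : N →ₗ[A] simpleTop 𝒜 := φ ∘ₗ JN.mkQ
  refine ⟨-k, gradedPart ψ (-k), ?_⟩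
  rw [gradedPart_apply, neg_neg]
  exact hφ

end SimpleTop

end GrMod

/-! ### The extension `J → A → S` and factorizations through shifts of `J` -/

namespace GrMod

variable {A : Type u} [Ring A] {𝒜 : ℕ → AddSubgroup A}

theorem lin_sum {M N : GrMod 𝒜} {ι : Type*} (s : Finset ι) (f : ι → (M ⟶ N)) :
    lin (∑ i ∈ s, f i) = ∑ i ∈ s, lin (f i) :=
  map_sum (AddMonoidHom.mk' (fun f : M ⟶ N => lin f) fun _ _ => rfl) f s

variable [GradedRing 𝒜]

variable (𝒜) in
/-- The graded radical as a graded module. -/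
noncomputable def radicalModule : GrMod 𝒜 :=
  (regular 𝒜).sub (gradedRadical 𝒜) (gradedRadical_homogeneous 𝒜)

variable (𝒜) in
/-- The inclusion `J → A`. -/
noncomputable def radicalι : radicalModule 𝒜 ⟶ regular 𝒜 :=
  (regular 𝒜).subι (gradedRadical 𝒜) (gradedRadical_homogeneous 𝒜)

variable (𝒜) in
/-- The projection `A → S`. -/
noncomputable def simpleTopπ : regular 𝒜 ⟶ simpleTop 𝒜 :=
  (regular 𝒜).quotπ (gradedRadical 𝒜) (gradedRadical_homogeneous 𝒜)

theorem simpleTopπ_surjective : Function.Surjective (lin (simpleTopπ 𝒜)) :=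
  (gradedRadical 𝒜).mkQ_surjective

theorem radicalι_simpleTopπ : radicalι 𝒜 ≫ simpleTopπ 𝒜 = 0 :=
  hom_ext fun (x : gradedRadical 𝒜) => (Submodule.Quotient.mk_eq_zero _).2 x.2

variable (𝒜) in
/-- The short complex `J → A → S`. -/
noncomputable def radicalSes : ShortComplex (GrMod 𝒜) :=
  ShortComplex.mk (radicalι 𝒜) (simpleTopπ 𝒜) radicalι_simpleTopπ

theorem radicalSes_shortExact : (radicalSes 𝒜).ShortExact :=
  shortExact_of_ker (simpleTopπ 𝒜) simpleTopπ_surjective _ _ (gradedRadical 𝒜).ker_mkQ.symm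
    radicalι_simpleTopπ

theorem lin_regular_mem_radical {P : GrMod 𝒜} {a : ℤ}
    (h : P ⟶ (shiftFunctor 𝒜 a).obj (regular 𝒜)) {x : P}
    (hx : x ∈ gradedRadical 𝒜 • (⊤ : Submodule A P)) :
    lin (N := (regular 𝒜).shift a) h x ∈ gradedRadical 𝒜 := by
  refine Submodule.smul_induction_on
    (p := fun x => lin (N := (regular 𝒜).shift a) h x ∈ gradedRadical 𝒜) hx ?_ ?_
  · intro a ha y _
    rw [map_smul]
    exact (gradedRadical 𝒜).mul_mem_right _ ha
  · intro x y hx hy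
    rw [map_add]
    exact add_mem hx hy

/-- The restriction of a map `P → A(a)` to a submodule of `J P`, with values in `J(a)`. -/
noncomputable def restrictRadical {P : GrMod 𝒜} {a : ℤ}
    (h : P ⟶ (shiftFunctor 𝒜 a).obj (regular 𝒜)) (N : Submodule A P)
    (hN : ∀ k, ∀ m ∈ N, P.proj k m ∈ N)
    (hNJ : N ≤ gradedRadical 𝒜 • (⊤ : Submodule A P)) :
    P.sub N hN ⟶ (shiftFunctor 𝒜 a).obj (radicalModule 𝒜) :=
  ofLin (M := P.sub N hN) (N := (radicalModule 𝒜).shift a)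
    (LinearMap.codRestrict (gradedRadical 𝒜)
      (lin (N := (regular 𝒜).shift a) h ∘ₗ N.subtype)
      fun x => lin_regular_mem_radical h (hNJ x.2))
    fun k x hx => lin_mem (N := (regular 𝒜).shift a) h k x.1 hx

/-- The coordinate `P → A(-dᵢ)` of a dual basis. -/
noncomputable def DualBasis.coordHom {P : GrMod 𝒜} (B : DualBasis P) (i : B.I) :
    P ⟶ (shiftFunctor 𝒜 (-B.d i)).obj (regular 𝒜) :=
  ofLin (N := (regular 𝒜).shift (-B.d i)) (Finsupp.lapply i ∘ₗ B.coord) fun k x hx =>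
    B.coord_mem k x hx i

/-- If `N ⊆ J P` and `N ∩ J² P ⊆ J N`, then every linear map `N → S` extends to `J P`. -/
theorem exists_extension_radical (hsemi : IsSemiperfectRing (𝒜 0)) {P : Type u} [AddCommGroup P]
    [Module A P] (N : Submodule A P) (hNJ : N ≤ gradedRadical 𝒜 • (⊤ : Submodule A P))
    (hJ : N ⊓ gradedRadical 𝒜 • gradedRadical 𝒜 • (⊤ : Submodule A P) ≤ gradedRadical 𝒜 • N)
    (u : N →ₗ[A] simpleTop 𝒜) :
    ∃ φ : (gradedRadical 𝒜 • (⊤ : Submodule A P) : Submodule A P) →ₗ[A] simpleTop 𝒜,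
      ∀ x (hx : x ∈ N), φ ⟨x, hNJ hx⟩ = u ⟨x, hx⟩ := by
  have hss := isSemisimpleRing_quotient_gradedRadical hsemi
  set JP : Submodule A P := gradedRadical 𝒜 • ⊤ with hJP
  let JJ : Submodule A JP := (gradedRadical 𝒜 • JP).comap JP.subtype
  have hW : ∀ a ∈ gradedRadical 𝒜, ∀ w : JP ⧸ JJ, a • w = 0 := by
    rintro a ha w
    obtain ⟨x, rfl⟩ := JJ.mkQ_surjective w
    exact (Submodule.Quotient.mk_eq_zero _).2 (Submodule.smul_mem_smul ha x.2)
  have hssW := isSemisimpleModule_of_smul_eq_zero (gradedRadical 𝒜) hW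
  have hssS : IsSemisimpleModule A (simpleTop 𝒜) :=
    isSemisimpleModule_of_smul_eq_zero (gradedRadical 𝒜) fun a ha x => radical_smul_simpleTop ha x
  -- The kernel of `ψ` is `N ∩ J² P`, contained in `J N`, where `u` vanishes. Hence `u` descends to
  -- the image of `ψ` and extends to the semisimple module `J P / J² P`.
  let ψ : N →ₗ[A] JP ⧸ JJ := JJ.mkQ ∘ₗ Submodule.inclusion hNJ
  have hker : LinearMap.ker ψ ≤ LinearMap.ker u := by
    intro x hx
    have h1 : Submodule.inclusion hNJ x ∈ JJ := (Submodule.Quotient.mk_eq_zero _).1 hx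
    have h2 : (x : P) ∈ gradedRadical 𝒜 • N := hJ ⟨x.2, h1⟩
    have h3 : x ∈ gradedRadical 𝒜 • (⊤ : Submodule A N) := by
      have : (x : P) ∈ (gradedRadical 𝒜 • (⊤ : Submodule A N)).map N.subtype := by
        rwa [Submodule.map_smul'', Submodule.map_top, Submodule.range_subtype]
      obtain ⟨y, hy, hyx⟩ := this
      rwa [← Subtype.ext hyx]
    exact linearMap_simpleTop_eq_zero u h3
  obtain ⟨φ, hφ⟩ := IsSemisimpleModule.extension_property
    ((LinearMap.ker ψ).liftQ ψ le_rfl)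
    (LinearMap.ker_eq_bot.1 (Submodule.ker_liftQ_eq_bot _ _ _ le_rfl))
    ((LinearMap.ker ψ).liftQ u hker)
  refine ⟨φ ∘ₗ JJ.mkQ, fun x hx => ?_⟩
  exact LinearMap.congr_fun hφ ((LinearMap.ker ψ).mkQ ⟨x, hx⟩)

/-- Let `P` have a locally finite dual basis and let `N ⊆ J P` satisfy `N ∩ J² P ⊆ J N`. Every map
`N → S(l)` is a sum of composites `N → J(a) → S(l)` where `N → J(a)` extends to `P → A(a)`. -/
theorem DualBasis.exists_factorization (hsemi : IsSemiperfectRing (𝒜 0)) {P : GrMod 𝒜}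
    (B : DualBasis P) (N : Submodule A P) (hN : ∀ k, ∀ m ∈ N, P.proj k m ∈ N)
    (hNJ : N ≤ gradedRadical 𝒜 • (⊤ : Submodule A P))
    (hJ : N ⊓ gradedRadical 𝒜 • gradedRadical 𝒜 • (⊤ : Submodule A P) ≤ gradedRadical 𝒜 • N)
    {l : ℤ} (u : P.sub N hN ⟶ (shiftFunctor 𝒜 l).obj (simpleTop 𝒜)) :
    ∃ (s : Finset B.I) (g : ∀ i, (shiftFunctor 𝒜 (-B.d i)).obj (radicalModule 𝒜) ⟶
      (shiftFunctor 𝒜 l).obj (simpleTop 𝒜)),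
      u = ∑ i ∈ s, restrictRadical (B.coordHom i) N hN hNJ ≫ g i := by
  obtain ⟨φ, hφ⟩ := exists_extension_radical hsemi N hNJ hJ (toSimpleTop u)
  -- Extending `u` to `φ` on `J P` gives `u(x) = ∑ φ(xᵢ • vᵢ)` for the coordinates `xᵢ ∈ J` of `x`.
  -- The map `ψ i` is `c ↦ φ(c • vᵢ)` on `J`.
  let ψ (i : B.I) : gradedRadical 𝒜 →ₗ[A] simpleTop 𝒜 := φ ∘ₗ
    LinearMap.codRestrict _ (LinearMap.toSpanSingleton A P (B.v i) ∘ₗ (gradedRadical 𝒜).subtype)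
      fun x => Submodule.smul_mem_smul x.2 trivial
  -- A map to `S(l)` only sees elements of degree `-l`, whose coordinates vanish when `d i > -l`.
  -- Local finiteness of the basis thus makes the sum finite, uniformly in the element.
  let s := (B.finite (-l)).toFinset
  let g (i : B.I) := gradedPart (N := (radicalModule 𝒜).shift (-B.d i)) (ψ i) l
  refine ⟨s, g, hom_ext fun x => ?_⟩
  rw [lin_sum, LinearMap.sum_apply]
  let y : N := (P.sub N hN).proj (-l) x
  have hy : (y : P) ∈ P.grading (-l) := (P.sub N hN).proj_mem (-l) x
  have hyJ : ∀ i, B.coord y i ∈ gradedRadical 𝒜 := B.coord_mem_radical (hNJ y.2)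
  have hx : ∀ i, lin (restrictRadical (B.coordHom i) N hN hNJ ≫ g i) x =
      φ ⟨B.coord y i • B.v i, Submodule.smul_mem_smul (hyJ i) trivial⟩ := by
    intro i
    exact congrArg (ψ i) (lin_proj (N := (radicalModule 𝒜).shift (-B.d i))
      (restrictRadical (B.coordHom i) N hN hNJ) (-l) x).symm
  have hsum : ∑ i ∈ s, B.coord y i • B.v i = y := by
    conv_rhs => rw [← B.sum_coord y, Finsupp.linearCombination_apply]
    refine (Finsupp.sum_of_support_subset _ (fun i hi => ?_) (fun i a => a • B.v i)
      fun _ _ => zero_smul _ _).symm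
    rw [Set.Finite.mem_toFinset]
    by_contra hlt
    refine Finsupp.mem_support_iff.1 hi (intGrading_eq_zero ?_ (B.coord_mem _ _ hy i))
    rw [Set.mem_ofPred_eq] at hlt
    lia
  have h1 : lin u x = toSimpleTop u y := (toSimpleTop_proj u x).symm
  refine (h1.trans (hφ y y.2).symm).trans ?_
  refine Eq.trans ?_ (Finset.sum_congr rfl fun i _ => (hx i).symm)
  refine Eq.trans ?_ (map_sum φ _ s)
  refine congrArg φ (Subtype.ext ?_)
  rw [AddSubmonoidClass.coe_finsetSum]
  exact hsum.symm

end GrMod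

/-! ### Yoneda products and dimension shifting -/

namespace GrMod

variable {A : Type u} [Ring A] {𝒜 : ℕ → AddSubgroup A}

theorem yoneda_of {X Y Z : GrMod 𝒜} {i j n : ℕ} (h : i + j = n) (a b : ℤ)
    (β : Abelian.Ext.{u + 1} Y ((shiftFunctor 𝒜 b).obj Z) j)
    (α : Abelian.Ext.{u + 1} X ((shiftFunctor 𝒜 a).obj Y) i) :
    yoneda h (DirectSum.of (fun l => Abelian.Ext.{u + 1} Y ((shiftFunctor 𝒜 l).obj Z) j) b β)
      (DirectSum.of (fun l => Abelian.Ext.{u + 1} X ((shiftFunctor 𝒜 l).obj Y) i) a α) =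
    DirectSum.of (fun l => Abelian.Ext.{u + 1} X ((shiftFunctor 𝒜 l).obj Z) n) (a + b)
      (yonedaHom h a b β α) := by
  rw [yoneda, DirectSum.toAddMonoid_of, AddMonoidHom.flip_apply, DirectSum.toAddMonoid_of]
  rfl

/-- A homomorphism vanishes on all Yoneda products if it vanishes on the homogeneous ones. -/
theorem yoneda_induction {X Y Z : GrMod 𝒜} {i j n : ℕ} (h : i + j = n) {H : Type*} [AddCommGroup H]
    (φ : GExt X Z n →+ H)
    (hφ : ∀ a b (β : Abelian.Ext.{u + 1} Y ((shiftFunctor 𝒜 b).obj Z) j)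
      (α : Abelian.Ext.{u + 1} X ((shiftFunctor 𝒜 a).obj Y) i),
      φ (DirectSum.of (fun l => Abelian.Ext.{u + 1} X ((shiftFunctor 𝒜 l).obj Z) n) (a + b)
        (yonedaHom h a b β α)) = 0) (β : GExt Y Z j) (α : GExt X Y i) :
    φ (yoneda h β α) = 0 := by
  induction β using DirectSum.induction_on with
  | zero => simp
  | add x y hx hy => rw [map_add, AddMonoidHom.add_apply, map_add, hx, hy, add_zero]
  | of b β =>
    induction α using DirectSum.induction_on with
    | zero => simp
    | add x y hx hy => rw [map_add, map_add, hx, hy, add_zero]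
    | of a α => rw [yoneda_of, hφ]

/-! ### Ext groups and resolutions -/

theorem _root_.CategoryTheory.Abelian.Ext.comp_mk₀_comp_of_naturality {C : Type*} [Category C]
    [Abelian C] [HasExt C] {M X X' K J W V : C} {n m : ℕ} (h : n + 1 = m)
    (α : Abelian.Ext M X n) (f : X ⟶ X') (ε : Abelian.Ext X K 1) (ε' : Abelian.Ext X' J 1)
    (τ : K ⟶ J) (g : J ⟶ W) (s : W ⟶ V)
    (hτ : ε.comp (Abelian.Ext.mk₀ τ) (add_zero 1) = (Abelian.Ext.mk₀ f).comp ε' (zero_add 1)) :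
    ((α.comp (Abelian.Ext.mk₀ f) (add_zero n)).comp
      (ε'.comp (Abelian.Ext.mk₀ g) (add_zero 1)) h).comp (Abelian.Ext.mk₀ s) (add_zero m) =
    (α.comp ε h).comp (Abelian.Ext.mk₀ (τ ≫ g ≫ s)) (add_zero m) := by
  rw [← Abelian.Ext.mk₀_comp_mk₀, ← Abelian.Ext.mk₀_comp_mk₀]
  simp only [Abelian.Ext.comp_assoc_of_third_deg_zero, Abelian.Ext.comp_assoc_of_second_deg_zero]
  rw [← Abelian.Ext.comp_assoc_of_third_deg_zero ε, hτ]
  simp only [Abelian.Ext.comp_assoc_of_third_deg_zero]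

namespace GrProjRes

variable {M : GrMod 𝒜} (R : GrProjRes M)

/-- The class in `Extⁿ(M, Ωⁿ M)` of the truncated resolution. -/
noncomputable def resClass : (n : ℕ) → Abelian.Ext.{u + 1} M (R.syz n) n
  | 0 => Abelian.Ext.mk₀ (𝟙 M)
  | n + 1 => (resClass n).comp (R.ses_shortExact n).extClass rfl

/-- Dimension shifting: `Ext` groups of `Pₙ` vanish in positive degrees, so every connecting map
`Extʲ(Ωⁿ⁺¹, Y) → Extʲ⁺¹(Ωⁿ, Y)` is surjective, including `j = 0`. -/
theorem exists_resClass_comp (Y : GrMod 𝒜) (n : ℕ) : ∀ (j m : ℕ) (h : n + j = m)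
    (x : Abelian.Ext.{u + 1} M Y m), ∃ y : Abelian.Ext.{u + 1} (R.syz n) Y j,
      (R.resClass n).comp y h = x := by
  induction n with
  | zero =>
    intro j m h x
    obtain rfl : j = m := by simpa using h
    exact ⟨x, Abelian.Ext.mk₀_id_comp x⟩
  | succ n ih =>
    intro j m h x
    obtain ⟨y, hy⟩ := ih (j + 1) m (by lia) x
    have := R.projective n
    obtain ⟨z, hz⟩ := Abelian.Ext.contravariant_sequence_exact₃ (R.ses_shortExact n) Y y
      (Abelian.Ext.eq_zero_of_projective (P := R.P n) _) (add_comm 1 j)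
    refine ⟨z, ?_⟩
    rw [← hy, ← hz]
    exact Abelian.Ext.comp_assoc _ _ _ _ _ (by lia)

/-- The same exact sequences give injectivity, but only for `y` of positive degree: in degree zero
the maps that extend to `Pₙ` are lost. -/
theorem eq_zero_of_resClass_comp (Y : GrMod 𝒜) (n : ℕ) : ∀ (j m : ℕ) (h : n + (j + 1) = m)
    (y : Abelian.Ext.{u + 1} (R.syz n) Y (j + 1)), (R.resClass n).comp y h = 0 → y = 0 := by
  induction n with
  | zero =>
    intro j m h y hy
    obtain rfl : j + 1 = m := by simpa using h
    exact (Abelian.Ext.mk₀_id_comp y).symm.trans hy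
  | succ n ih =>
    intro j m h y hy
    have h1 : (R.ses_shortExact n).extClass.comp y (add_comm 1 (j + 1)) = 0 := by
      refine ih (j + 1) m (by lia) _ ?_
      rw [← hy]
      exact (Abelian.Ext.comp_assoc _ _ _ _ _ (by lia)).symm
    obtain ⟨z, rfl⟩ := Abelian.Ext.contravariant_sequence_exact₁ (R.ses_shortExact n) Y y _ h1
    have : Projective (R.ses n).X₂ := R.projective n
    rw [Abelian.Ext.eq_zero_of_projective z, Abelian.Ext.comp_zero]
    rfl

theorem exists_mk₀ (Y : GrMod 𝒜) (n : ℕ) (x : Abelian.Ext.{u + 1} M Y n) :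
    ∃ f : R.syz n ⟶ Y, (R.resClass n).comp (Abelian.Ext.mk₀ f) (add_zero n) = x := by
  obtain ⟨y, rfl⟩ := R.exists_resClass_comp Y n 0 n (add_zero n) x
  obtain ⟨f, rfl⟩ := (Abelian.Ext.mk₀_bijective _ _).2 y
  exact ⟨f, rfl⟩

variable [GradedRing 𝒜] {R}

theorem IsMinimal.incl_comp (hR : R.IsMinimal) (n : ℕ) {l : ℤ}
    (v : R.P n ⟶ (shiftFunctor 𝒜 l).obj (simpleTop 𝒜)) : R.incl n ≫ v = 0 :=
  hom_ext fun (x : R.kerD n) => linearMap_simpleTop_eq_zero (toSimpleTop v) (hR.kerD_le n x.2)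

/-- This is the degree-zero case of injectivity, special to shifts of `S`. The possible kernel
consists of maps that extend to `Pₙ`, and minimality makes those zero. -/
theorem IsMinimal.eq_zero_of_resClass_comp_mk₀ (hR : R.IsMinimal) (n : ℕ) {l : ℤ}
    (f : R.syz n ⟶ (shiftFunctor 𝒜 l).obj (simpleTop 𝒜))
    (hf : (R.resClass n).comp (Abelian.Ext.mk₀ f) (add_zero n) = 0) : f = 0 := by
  cases n with
  | zero =>
    rw [← Abelian.Ext.mk₀_eq_zero_iff]
    exact (Abelian.Ext.mk₀_id_comp _).symm.trans hf
  | succ n =>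
    have h1 : (R.ses_shortExact n).extClass.comp (Abelian.Ext.mk₀ f) (add_zero 1) = 0 := by
      refine R.eq_zero_of_resClass_comp _ n 0 (n + 1) rfl _ ?_
      rw [← hf]
      exact (Abelian.Ext.comp_assoc _ _ _ _ _ rfl).symm
    obtain ⟨z, hz⟩ :=
      Abelian.Ext.contravariant_sequence_exact₁ (R.ses_shortExact n) _ (Abelian.Ext.mk₀ f) _ h1
    obtain ⟨v, rfl⟩ := (Abelian.Ext.mk₀_bijective _ _).2 z
    rw [Abelian.Ext.mk₀_comp_mk₀] at hz
    rw [← (Abelian.Ext.mk₀_bijective _ _).1 hz]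
    exact hR.incl_comp n v

/-- `Hom(Ωⁿ M, S(l)) ≅ Extⁿ(M, S(l))` for a minimal resolution of `M`. -/
noncomputable def IsMinimal.extEquiv (hR : R.IsMinimal) (n : ℕ) (l : ℤ) :
    (R.syz n ⟶ (shiftFunctor 𝒜 l).obj (simpleTop 𝒜)) ≃+
      Abelian.Ext.{u + 1} M ((shiftFunctor 𝒜 l).obj (simpleTop 𝒜)) n :=
  AddEquiv.ofBijective
    (AddMonoidHom.mk' (fun f => (R.resClass n).comp (Abelian.Ext.mk₀ f) (add_zero n))
      fun f g => by rw [Abelian.Ext.mk₀_add, Abelian.Ext.comp_add])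
    ⟨(injective_iff_map_eq_zero _).2 fun f => hR.eq_zero_of_resClass_comp_mk₀ n f,
      R.exists_mk₀ _ n⟩

/-- The homomorphism on the graded group `Extⁿ(M, S) = ⨁ₗ Hom(Ωⁿ M, S(l))` given by the evaluation
of maps at an element of `Ωⁿ M`. -/
noncomputable def IsMinimal.evalExt (hR : R.IsMinimal) (n : ℕ) (x : R.syz n) :
    GExt M (simpleTop 𝒜) n →+ simpleTop 𝒜 :=
  DirectSum.toAddMonoid fun l =>
    (AddMonoidHom.mk' (fun f : R.syz n ⟶ (shiftFunctor 𝒜 l).obj (simpleTop 𝒜) =>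
      toSimpleTop f x) fun _ _ => rfl).comp (hR.extEquiv n l).symm.toAddMonoidHom

theorem IsMinimal.evalExt_of (hR : R.IsMinimal) (n : ℕ) (x : R.syz n) (l : ℤ)
    (f : R.syz n ⟶ (shiftFunctor 𝒜 l).obj (simpleTop 𝒜)) :
    hR.evalExt n x (DirectSum.of (fun l => Abelian.Ext.{u + 1} M
      ((shiftFunctor 𝒜 l).obj (simpleTop 𝒜)) n) l
        ((R.resClass n).comp (Abelian.Ext.mk₀ f) (add_zero n))) = toSimpleTop f x := by
  rw [evalExt, DirectSum.toAddMonoid_of]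
  exact congrArg (fun f => toSimpleTop f x) ((hR.extEquiv n l).symm_apply_apply f)

end GrProjRes

/-! ### Products with `Ext¹(S, S)` and the quasi-Koszul criterion -/

variable [GradedRing 𝒜]

theorem regular_projective : Projective (regular 𝒜) :=
  DualBasis.projective
    { I := Unit
      d := fun _ => 0
      finite := fun _ => Set.toFinite _
      v := fun _ => (1 : A)
      v_mem := fun _ => SetLike.one_mem_graded 𝒜
      coord := (Finsupp.lsingle () : A →ₗ[A] Unit →₀ A)
      coord_mem := fun k x hx _ => by
        rw [sub_zero]
        exact (Finsupp.single_eq_same (a := ()) (b := (x : A))).symm ▸ hx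
      sum_coord := fun x => (Finsupp.linearCombination_single A x ()).trans (mul_one (M := A) x) }

variable (𝒜) in
/-- The class of the extension `J → A → S`. -/
noncomputable def radicalClass : Abelian.Ext.{u + 1} (simpleTop 𝒜) (radicalModule 𝒜) 1 :=
  radicalSes_shortExact.extClass

variable (𝒜) in
/-- The class of the extension `J(a) → A(a) → S(a)`. -/
noncomputable def shiftedRadicalClass (a : ℤ) :
    Abelian.Ext.{u + 1} ((shiftFunctor 𝒜 a).obj (simpleTop 𝒜))
      ((shiftFunctor 𝒜 a).obj (radicalModule 𝒜)) 1 :=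
  (radicalSes_shortExact.map_of_exact (shiftFunctor 𝒜 a)).extClass

theorem radicalClass_mapExactFunctor (a : ℤ) :
    (radicalClass 𝒜).mapExactFunctor (shiftFunctor 𝒜 a) = shiftedRadicalClass 𝒜 a :=
  Abelian.Ext.mapExactFunctor_extClass (shiftFunctor 𝒜 a) radicalSes_shortExact

/-- `Ext¹(A, Y) = 0`, so the connecting map `Hom(J, Y) → Ext¹(S, Y)` is surjective. -/
theorem exists_radicalClass_comp {Y : GrMod 𝒜} (x : Abelian.Ext.{u + 1} (simpleTop 𝒜) Y 1) :
    ∃ g : radicalModule 𝒜 ⟶ Y,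
      (radicalClass 𝒜).comp (Abelian.Ext.mk₀ g) (add_zero 1) = x := by
  have := regular_projective (𝒜 := 𝒜)
  obtain ⟨z, rfl⟩ := Abelian.Ext.contravariant_sequence_exact₃ radicalSes_shortExact Y x
      (Abelian.Ext.eq_zero_of_projective (P := regular 𝒜) _) (add_zero 1)
  obtain ⟨f, rfl⟩ := (Abelian.Ext.mk₀_bijective _ _).2 z
  exact ⟨f, rfl⟩

namespace GrProjRes

variable {M : GrMod 𝒜} {R : GrProjRes M}

/-- A lift `h` of `f` gives a morphism from `Ωⁿ⁺¹ → Pₙ → Ωⁿ` to `J(a) → A(a) → S(a)`. Naturality of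
the extension class then moves the product with `f` into a composite on `Ωⁿ⁺¹`. -/
theorem IsMinimal.yonedaHom_radicalClass (hR : R.IsMinimal) {Z : GrMod 𝒜} (n : ℕ) {a b : ℤ}
    (h : R.P n ⟶ (shiftFunctor 𝒜 a).obj (regular 𝒜))
    (f : R.syz n ⟶ (shiftFunctor 𝒜 a).obj (simpleTop 𝒜))
    (hf : R.cover n ≫ f = h ≫ (shiftFunctor 𝒜 a).map (simpleTopπ 𝒜))
    (g : radicalModule 𝒜 ⟶ (shiftFunctor 𝒜 b).obj Z) :
    yonedaHom (rfl : n + 1 = n + 1) a b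
      ((radicalClass 𝒜).comp (Abelian.Ext.mk₀ g) (add_zero 1))
      ((R.resClass n).comp (Abelian.Ext.mk₀ f) (add_zero n)) =
    (R.resClass (n + 1)).comp (Abelian.Ext.mk₀
      (restrictRadical h (R.kerD n) (R.kerD_homogeneous n) (hR.kerD_le n) ≫
        (shiftFunctor 𝒜 a).map g ≫ Z.shiftShift a b)) (add_zero (n + 1)) := by
  let τ : R.ses n ⟶ (radicalSes 𝒜).map (shiftFunctor 𝒜 a) :=
    { τ₁ := restrictRadical h (R.kerD n) (R.kerD_homogeneous n) (hR.kerD_le n)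
      τ₂ := h
      τ₃ := f
      comm₁₂ := rfl
      comm₂₃ := hf.symm }
  have hnat := ShortComplex.ShortExact.extClass_naturality (R.ses_shortExact n)
    (radicalSes_shortExact.map_of_exact (shiftFunctor 𝒜 a)) τ
  unfold yonedaHom
  rw [Abelian.Ext.mapExactFunctor_comp, radicalClass_mapExactFunctor,
    Abelian.Ext.mapExactFunctor_mk₀]
  exact Abelian.Ext.comp_mk₀_comp_of_naturality rfl _ _ _ _ _ _ _ hnat

/-- Converse of the lifting step: the composite of `h` with `A(a) → S(a)` kills `Ωⁿ⁺¹` by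
minimality, so it descends to `Ωⁿ`. -/
theorem IsMinimal.exists_comp_eq (hR : R.IsMinimal) (n : ℕ) {a : ℤ}
    (h : R.P n ⟶ (shiftFunctor 𝒜 a).obj (regular 𝒜)) :
    ∃ f : R.syz n ⟶ (shiftFunctor 𝒜 a).obj (simpleTop 𝒜),
      R.cover n ≫ f = h ≫ (shiftFunctor 𝒜 a).map (simpleTopπ 𝒜) := by
  have := (R.ses_shortExact n).epi_g
  exact ⟨(R.ses_shortExact n).exact.desc _ (hR.incl_comp n _),
    (R.ses_shortExact n).exact.g_desc _ (hR.incl_comp n _)⟩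

theorem exists_lift (R : GrProjRes M) (n : ℕ) {a : ℤ}
    (f : R.syz n ⟶ (shiftFunctor 𝒜 a).obj (simpleTop 𝒜)) :
    ∃ h : R.P n ⟶ (shiftFunctor 𝒜 a).obj (regular 𝒜),
      R.cover n ≫ f = h ≫ (shiftFunctor 𝒜 a).map (simpleTopπ 𝒜) := by
  have := R.projective n
  have : Epi (simpleTopπ 𝒜) := radicalSes_shortExact.epi_g
  exact ⟨Projective.factorThru (R.cover n ≫ f) ((shiftFunctor 𝒜 a).map (simpleTopπ 𝒜)),
    (Projective.factorThru_comp _ _).symm⟩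

theorem IsMinimal.smul_kerD_le (hR : R.IsMinimal) (n : ℕ) :
    gradedRadical 𝒜 • R.kerD n ≤
      R.kerD n ⊓ gradedRadical 𝒜 • gradedRadical 𝒜 • (⊤ : Submodule A (R.P n)) :=
  le_inf Submodule.smul_le_right (Submodule.smul_mono le_rfl (hR.kerD_le n))

end GrProjRes

/-- If all products `Ext¹(S, S) · Extⁿ(M, S)` span, then `J Ker dₙ = Ker dₙ ∩ J² Pₙ`. -/
theorem GrProjRes.IsMinimal.smul_kerD_eq (hsemi : IsSemiperfectRing (𝒜 0)) {M : GrMod 𝒜}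
    {R : GrProjRes M} (hR : R.IsMinimal) (n : ℕ)
    (hn : yonedaSpan M (simpleTop 𝒜) (simpleTop 𝒜) 1 n (n + 1) rfl = ⊤) :
    gradedRadical 𝒜 • R.kerD n =
      R.kerD n ⊓ gradedRadical 𝒜 • gradedRadical 𝒜 • (⊤ : Submodule A (R.P n)) := by
  refine le_antisymm (hR.smul_kerD_le n) ?_
  rintro x ⟨hxK, hxJ⟩
  by_contra hx
  let x' : R.syz (n + 1) := (⟨x, hxK⟩ : R.kerD n)
  have hx' : x' ∉ gradedRadical 𝒜 • (⊤ : Submodule A (R.syz (n + 1))) := fun h => hx (by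
    have h1 : x ∈ (gradedRadical 𝒜 • (⊤ : Submodule A (R.kerD n))).map (R.kerD n).subtype :=
      ⟨x', h, rfl⟩
    rwa [Submodule.map_smul'', Submodule.map_top, Submodule.range_subtype] at h1)
  obtain ⟨l, u, hu⟩ := exists_toSimpleTop_ne_zero hsemi hx'
  refine hu ?_
  rw [← hR.evalExt_of (n + 1) x' l u]
  generalize DirectSum.of (fun l => Abelian.Ext.{u + 1} M
      ((shiftFunctor 𝒜 l).obj (simpleTop 𝒜)) (n + 1)) l _ = γ
  have hγ : γ ∈ yonedaSpan M (simpleTop 𝒜) (simpleTop 𝒜) 1 n (n + 1) rfl := by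
    rw [hn]; trivial
  -- Evaluation at `x'` is additive on the graded Ext group, so it suffices that it kills each
  -- homogeneous product.
  suffices hle : yonedaSpan M (simpleTop 𝒜) (simpleTop 𝒜) 1 n (n + 1) rfl ≤
      (hR.evalExt (n + 1) x').ker from hle hγ
  refine (AddSubgroup.closure_le _).2 ?_
  rintro _ ⟨β, α, rfl⟩
  refine yoneda_induction rfl (hR.evalExt (n + 1) x') (fun a b β α => ?_) β α
  obtain ⟨g, rfl⟩ := exists_radicalClass_comp β
  obtain ⟨f, rfl⟩ := R.exists_mk₀ _ n α
  obtain ⟨h, hf⟩ := R.exists_lift n f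
  rw [hR.yonedaHom_radicalClass n h f hf g, hR.evalExt_of]
  let η : R.P n →ₗ[A] A := lin (N := (regular 𝒜).shift a) h
  -- `x ∈ J² Pₙ` is sent by `h` into `J · J`, on which any map from `J` to a shift of `S` vanishes.
  have h1 : η x ∈ gradedRadical 𝒜 • gradedRadical 𝒜 := by
    have h2 := Submodule.mem_map_of_mem (f := η) hxJ
    rw [Submodule.map_smul''] at h2
    refine Submodule.smul_mono le_rfl ?_ h2
    rintro _ ⟨y, hy, rfl⟩
    exact lin_regular_mem_radical h hy
  refine linearMap_simpleTop_eq_zero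
    (toSimpleTop ((shiftFunctor 𝒜 a).map g ≫ (simpleTop 𝒜).shiftShift a b))
    (x := lin (restrictRadical h (R.kerD n) (R.kerD_homogeneous n) (hR.kerD_le n)) x') ?_
  have h3 : η x ∈
      (gradedRadical 𝒜 • (⊤ : Submodule A (gradedRadical 𝒜))).map (gradedRadical 𝒜).subtype := by
    rwa [Submodule.map_smul'', Submodule.map_top, Submodule.range_subtype]
  obtain ⟨z, hz, hzx⟩ := h3
  have : z = lin (restrictRadical h (R.kerD n) (R.kerD_homogeneous n) (hR.kerD_le n)) x' :=
    Subtype.ext hzx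
  exact this ▸ hz

theorem GrProjRes.IsMinimal.of_comp_mem_yonedaSpan {M : GrMod 𝒜} {R : GrProjRes M}
    (hR : R.IsMinimal) (n : ℕ) {a l : ℤ} (h : R.P n ⟶ (shiftFunctor 𝒜 a).obj (regular 𝒜))
    (g : (shiftFunctor 𝒜 a).obj (radicalModule 𝒜) ⟶ (shiftFunctor 𝒜 l).obj (simpleTop 𝒜)) :
    DirectSum.of (fun l => Abelian.Ext.{u + 1} M
      ((shiftFunctor 𝒜 l).obj (simpleTop 𝒜)) (n + 1)) l
        ((R.resClass (n + 1)).comp (Abelian.Ext.mk₀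
          (restrictRadical h (R.kerD n) (R.kerD_homogeneous n) (hR.kerD_le n) ≫ g))
            (add_zero (n + 1))) ∈
      yonedaSpan M (simpleTop 𝒜) (simpleTop 𝒜) 1 n (n + 1) rfl := by
  -- With `l = a + b`, the given map `J(a) → S(l)` is the shift by `a` of a map `J → S(b)`, which
  -- represents a class in `Ext¹(S, S(b))`.
  obtain ⟨b, rfl⟩ : ∃ b, l = a + b := ⟨l - a, by ring⟩
  obtain ⟨f, hf⟩ := hR.exists_comp_eq n h
  obtain ⟨g, rfl⟩ : ∃ g' : radicalModule 𝒜 ⟶ (shiftFunctor 𝒜 b).obj (simpleTop 𝒜),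
      (shiftFunctor 𝒜 a).map g' ≫ (simpleTop 𝒜).shiftShift a b = g := by
    let t : (shiftFunctor 𝒜 (a + b)).obj (simpleTop 𝒜) ⟶
        (shiftFunctor 𝒜 a).obj ((shiftFunctor 𝒜 b).obj (simpleTop 𝒜)) :=
      ofLin (M := (simpleTop 𝒜).shift (a + b)) (N := ((simpleTop 𝒜).shift b).shift a)
        LinearMap.id fun i m (hm : m ∈ (simpleTop 𝒜).grading _) => by
          change m ∈ (simpleTop 𝒜).grading _
          rwa [add_assoc]
    refine ⟨(shiftFunctor 𝒜 a).preimage (g ≫ t), ?_⟩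
    rw [Functor.map_preimage]
    rfl
  rw [← hR.yonedaHom_radicalClass n h f hf g, ← yoneda_of]
  exact AddSubgroup.subset_closure ⟨_, _, rfl⟩

/-- If `J Ker dₙ = Ker dₙ ∩ J² Pₙ` in a minimal resolution with locally finite dual bases, then
the products `Ext¹(S, S) · Extⁿ(M, S)` span `Extⁿ⁺¹(M, S)`. -/
theorem GrProjRes.IsMinimal.yonedaSpan_eq_top (hsemi : IsSemiperfectRing (𝒜 0)) {M : GrMod 𝒜}
    {R : GrProjRes M} (hR : R.IsMinimal) (n : ℕ) (B : DualBasis (R.P n))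
    (hJ : gradedRadical 𝒜 • R.kerD n =
      R.kerD n ⊓ gradedRadical 𝒜 • gradedRadical 𝒜 • (⊤ : Submodule A (R.P n))) :
    yonedaSpan M (simpleTop 𝒜) (simpleTop 𝒜) 1 n (n + 1) rfl = ⊤ := by
  refine eq_top_iff.2 fun γ _ => ?_
  induction γ using DirectSum.induction_on with
  | zero => exact zero_mem _
  | add x y hx hy => exact add_mem (hx trivial) (hy trivial)
  | of l x =>
    obtain ⟨u, rfl⟩ := R.exists_mk₀ _ (n + 1) x
    obtain ⟨s, g, hu⟩ := B.exists_factorization hsemi (R.kerD n) (R.kerD_homogeneous n)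
      (hR.kerD_le n) hJ.ge u
    -- `φ` is additive in the map on `Ωⁿ⁺¹`, so the factorization of `u` becomes a sum of Ext
    -- classes, each of them a Yoneda product.
    let φ : (R.syz (n + 1) ⟶ (shiftFunctor 𝒜 l).obj (simpleTop 𝒜)) →+
        GExt M (simpleTop 𝒜) (n + 1) :=
      (DirectSum.of (fun l => Abelian.Ext.{u + 1} M
        ((shiftFunctor 𝒜 l).obj (simpleTop 𝒜)) (n + 1)) l).comp
          (hR.extEquiv (n + 1) l).toAddMonoidHom
    have h1 : φ u = ∑ i ∈ s, φ (restrictRadical (B.coordHom i) (R.kerD n)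
        (R.kerD_homogeneous n) (hR.kerD_le n) ≫ g i) :=
      (congrArg φ hu).trans (map_sum φ _ s)
    change φ u ∈ _
    rw [h1]
    exact sum_mem fun i _ => hR.of_comp_mem_yonedaSpan n (B.coordHom i) (g i)

/-- Quasi-Koszul modules are characterized by their Ext groups. -/
theorem isQuasiKoszul_iff (hfin : IsLeftFiniteRing 𝒜) (hnoeth : IsNoetherianRing (𝒜 0))
    (hsemi : IsSemiperfectRing (𝒜 0)) {M : GrMod 𝒜} (hM : M.IsLeftFinite)
    (hb : M.IsBoundedBelow) :
    M.IsQuasiKoszul ↔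
      ∀ n : ℕ, yonedaSpan M (simpleTop 𝒜) (simpleTop 𝒜) 1 n (n + 1) rfl = ⊤ := by
  obtain ⟨R, hR, hB⟩ := exists_minimal_resolution hfin hnoeth hsemi hM hb
  -- The forward direction uses the constructed resolution, whose terms have locally finite dual
  -- bases. The converse applies to every minimal resolution.
  constructor
  · intro h n
    exact hR.yonedaSpan_eq_top hsemi n (hB n).some (h.2 R hR n)
  · intro h
    exact ⟨⟨R, hR⟩, fun R' hR' n => hR'.smul_kerD_eq hsemi n (h n)⟩

end GrMod

namespace GrMod

variable {A : Type u} [Ring A] {𝒜 : ℕ → AddSubgroup A}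

/-! ### Associativity and units of the Yoneda product -/

/-- The identity map `M(k) → M(k')` for `k = k'`. -/
def shiftCast (M : GrMod 𝒜) {k k' : ℤ} (h : k = k') :
    (shiftFunctor 𝒜 k).obj M ⟶ (shiftFunctor 𝒜 k').obj M :=
  ofLin (M := M.shift k) (N := M.shift k') LinearMap.id fun i m (hm : m ∈ M.grading _) => by
    change m ∈ M.grading _
    rwa [← h]

/-- The identity map `M → M(0)`. -/
def shiftZero (M : GrMod 𝒜) : M ⟶ (shiftFunctor 𝒜 0).obj M :=
  ofLin (M := M) (N := M.shift 0) LinearMap.id fun i m hm => by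
    change m ∈ M.grading _
    rwa [add_zero]

/-- Lets components be compared whose degrees, such as `a + (b + c)` and `a + b + c`, are equal but
not definitionally so. -/
theorem of_comp_shiftCast {X Z : GrMod 𝒜} {n : ℕ} {k k' : ℤ} (h : k = k')
    (x : Abelian.Ext.{u + 1} X ((shiftFunctor 𝒜 k).obj Z) n) :
    DirectSum.of (fun l => Abelian.Ext.{u + 1} X ((shiftFunctor 𝒜 l).obj Z) n) k'
      (x.comp (Abelian.Ext.mk₀ (Z.shiftCast h)) (add_zero n)) =
    DirectSum.of (fun l => Abelian.Ext.{u + 1} X ((shiftFunctor 𝒜 l).obj Z) n) k x := by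
  subst h
  exact congrArg _ (Abelian.Ext.comp_mk₀_id x)

/-- The compatibility of `ξ` with iterated shifts. -/
def IsShiftNatural {Z W : GrMod 𝒜} {p : ℕ} {c : ℤ}
    (ξ : Abelian.Ext.{u + 1} Z ((shiftFunctor 𝒜 c).obj W) p) : Prop :=
  ∀ a b : ℤ, ((ξ.mapExactFunctor (shiftFunctor 𝒜 b)).mapExactFunctor (shiftFunctor 𝒜 a)).comp
      (Abelian.Ext.mk₀ ((shiftFunctor 𝒜 a).map (W.shiftShift b c) ≫ W.shiftShift a (b + c) ≫
        W.shiftCast (add_assoc a b c).symm)) (add_zero p) =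
    (Abelian.Ext.mk₀ (Z.shiftShift a b)).comp
      ((ξ.mapExactFunctor (shiftFunctor 𝒜 (a + b))).comp
        (Abelian.Ext.mk₀ (W.shiftShift (a + b) c)) (add_zero p)) (zero_add p)

theorem isShiftNatural_mk₀ {Z W : GrMod 𝒜} {c : ℤ} (f : Z ⟶ (shiftFunctor 𝒜 c).obj W) :
    IsShiftNatural (Abelian.Ext.mk₀ f) := by
  intro a b
  simp only [Abelian.Ext.mapExactFunctor_mk₀, Abelian.Ext.mk₀_comp_mk₀]
  rfl

theorem isShiftNatural_of_degree_zero {Z W : GrMod 𝒜} {c : ℤ}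
    (ξ : Abelian.Ext.{u + 1} Z ((shiftFunctor 𝒜 c).obj W) 0) : IsShiftNatural ξ := by
  obtain ⟨f, rfl⟩ := (Abelian.Ext.mk₀_bijective _ _).2 ξ
  exact isShiftNatural_mk₀ f

theorem _root_.CategoryTheory.Abelian.Ext.comp_assoc_of_naturality {C : Type*} [Category C]
    [Abelian C] [HasExt C] {X Y Z Z' W₁ W₂ W₃ W₄ W : C} {p q r pq qr n : ℕ}
    (α : Abelian.Ext X Y r) (β : Abelian.Ext Y Z q) (ξ : Abelian.Ext Z W₁ p) (s₁ : W₁ ⟶ W₂)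
    (s₂ : W₂ ⟶ W₃) (s₃ : W₃ ⟶ W) (t : Z ⟶ Z') (ξ' : Abelian.Ext Z' W₄ p) (s₄ : W₄ ⟶ W)
    (h1 : q + p = pq) (h2 : r + pq = n) (h3 : r + q = qr) (h4 : qr + p = n)
    (h : ξ.comp (Abelian.Ext.mk₀ (s₁ ≫ s₂ ≫ s₃)) (add_zero p) =
      (Abelian.Ext.mk₀ t).comp (ξ'.comp (Abelian.Ext.mk₀ s₄) (add_zero p)) (zero_add p)) :
    ((α.comp ((β.comp ξ h1).comp (Abelian.Ext.mk₀ s₁) (add_zero pq)) h2).comp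
      (Abelian.Ext.mk₀ s₂) (add_zero n)).comp (Abelian.Ext.mk₀ s₃) (add_zero n) =
    (((α.comp β h3).comp (Abelian.Ext.mk₀ t) (add_zero qr)).comp ξ' h4).comp
      (Abelian.Ext.mk₀ s₄) (add_zero n) := by
  have e₁ : ((α.comp ((β.comp ξ h1).comp (Abelian.Ext.mk₀ s₁) (add_zero pq)) h2).comp
      (Abelian.Ext.mk₀ s₂) (add_zero n)).comp (Abelian.Ext.mk₀ s₃) (add_zero n) =
      α.comp (β.comp (ξ.comp (Abelian.Ext.mk₀ (s₁ ≫ s₂ ≫ s₃)) (add_zero p)) h1) h2 := by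
    simp only [Abelian.Ext.comp_assoc_of_third_deg_zero, Abelian.Ext.mk₀_comp_mk₀, Category.assoc]
  rw [e₁, h, Abelian.Ext.comp_assoc_of_third_deg_zero _ ξ',
    Abelian.Ext.comp_assoc_of_second_deg_zero]
  exact (Abelian.Ext.comp_assoc α β _ h3 h1 (by lia)).symm

theorem of_yonedaHom_assoc {X Y Z W : GrMod 𝒜} {p q r pq qr n : ℕ} {a b c : ℤ}
    {ξ : Abelian.Ext.{u + 1} Z ((shiftFunctor 𝒜 c).obj W) p} (hξ : IsShiftNatural ξ)
    (β : Abelian.Ext.{u + 1} Y ((shiftFunctor 𝒜 b).obj Z) q)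
    (α : Abelian.Ext.{u + 1} X ((shiftFunctor 𝒜 a).obj Y) r)
    (h1 : q + p = pq) (h2 : r + pq = n) (h3 : r + q = qr) (h4 : qr + p = n) :
    DirectSum.of (fun l => Abelian.Ext.{u + 1} X ((shiftFunctor 𝒜 l).obj W) n) (a + (b + c))
      (yonedaHom h2 a (b + c) (yonedaHom h1 b c ξ β) α) =
    DirectSum.of (fun l => Abelian.Ext.{u + 1} X ((shiftFunctor 𝒜 l).obj W) n) (a + b + c)
      (yonedaHom h4 (a + b) c ξ (yonedaHom h3 a b β α)) := by
  rw [← of_comp_shiftCast (add_assoc a b c).symm]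
  congr 1
  unfold yonedaHom
  simp only [Abelian.Ext.mapExactFunctor_comp, Abelian.Ext.mapExactFunctor_mk₀]
  exact Abelian.Ext.comp_assoc_of_naturality _ _ _ _ _ _ _ _ _ h1 h2 h3 h4 (hξ a b)

/-- One bracketing shifts `ξ` by `b` and then by `a`, the other by `a + b` at once. Agreement of the
two is a condition on the leftmost factor alone, and `hp` supplies it; what remains is associativity
of `Ext` composition. -/
theorem yoneda_assoc {X Y Z W : GrMod 𝒜} {p q r pq qr n : ℕ}
    (hp : ∀ (c : ℤ) (ξ : Abelian.Ext.{u + 1} Z ((shiftFunctor 𝒜 c).obj W) p), IsShiftNatural ξ)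
    (h1 : q + p = pq) (h2 : r + pq = n) (h3 : r + q = qr) (h4 : qr + p = n)
    (ξ : GExt Z W p) (β : GExt Y Z q) (α : GExt X Y r) :
    yoneda h2 (yoneda h1 ξ β) α = yoneda h4 ξ (yoneda h3 β α) := by
  induction ξ using DirectSum.induction_on with
  | zero => simp
  | add x y hx hy => simp only [map_add, AddMonoidHom.add_apply, hx, hy]
  | of c ξ =>
    induction β using DirectSum.induction_on with
    | zero => simp
    | add x y hx hy => simp only [map_add, AddMonoidHom.add_apply, hx, hy]
    | of b β =>
      induction α using DirectSum.induction_on with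
      | zero => simp
      | add x y hx hy => simp only [map_add, hx, hy]
      | of a α =>
        rw [yoneda_of, yoneda_of, yoneda_of, yoneda_of]
        exact of_yonedaHom_assoc (hp c ξ) β α h1 h2 h3 h4

/-- The unit of the Yoneda product. -/
noncomputable def yonedaOne (X : GrMod 𝒜) : GExt X X 0 :=
  DirectSum.of (fun l => Abelian.Ext.{u + 1} X ((shiftFunctor 𝒜 l).obj X) 0) 0
    (Abelian.Ext.mk₀ X.shiftZero)

theorem yonedaOne_yoneda {X Y : GrMod 𝒜} {n : ℕ} (α : GExt X Y n) :
    yoneda (add_zero n) (yonedaOne Y) α = α := by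
  induction α using DirectSum.induction_on with
  | zero => simp
  | add x y hx hy => rw [map_add, hx, hy]
  | of a α =>
    rw [yonedaOne, yoneda_of, ← of_comp_shiftCast (add_zero a).symm α]
    congr 1
    unfold yonedaHom
    rw [Abelian.Ext.mapExactFunctor_mk₀, Abelian.Ext.comp_assoc_of_third_deg_zero,
      Abelian.Ext.mk₀_comp_mk₀]
    rfl

/-! ### Shift compatibility of classes in `Ext¹` of `S` -/

section SimpleTop

variable [GradedRing 𝒜]

/-- By `exists_radicalClass_comp` it suffices to treat `J → A → S`. Identity maps form a morphism
from its iterated shift to its shift by `a + b`, and extension classes are natural. -/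
theorem radicalClass_isShiftNatural {W : GrMod 𝒜} {c : ℤ}
    (ξ : Abelian.Ext.{u + 1} (simpleTop 𝒜) ((shiftFunctor 𝒜 c).obj W) 1) :
    IsShiftNatural ξ := by
  obtain ⟨g, rfl⟩ := exists_radicalClass_comp ξ
  intro a b
  let τ : ((radicalSes 𝒜).map (shiftFunctor 𝒜 b)).map (shiftFunctor 𝒜 a) ⟶
      (radicalSes 𝒜).map (shiftFunctor 𝒜 (a + b)) :=
    { τ₁ := (radicalModule 𝒜).shiftShift a b
      τ₂ := (regular 𝒜).shiftShift a b
      τ₃ := (simpleTop 𝒜).shiftShift a b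
      comm₁₂ := rfl
      comm₂₃ := rfl }
  have hnat : ((shiftedRadicalClass 𝒜 b).mapExactFunctor (shiftFunctor 𝒜 a)).comp
      (Abelian.Ext.mk₀ ((radicalModule 𝒜).shiftShift a b)) (add_zero 1) =
      (Abelian.Ext.mk₀ ((simpleTop 𝒜).shiftShift a b)).comp
        (shiftedRadicalClass 𝒜 (a + b)) (zero_add 1) := by
    have hx : (shiftedRadicalClass 𝒜 b).mapExactFunctor (shiftFunctor 𝒜 a) =
        ((radicalSes_shortExact.map_of_exact (shiftFunctor 𝒜 b)).map_of_exact
          (shiftFunctor 𝒜 a)).extClass :=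
      Abelian.Ext.mapExactFunctor_extClass (shiftFunctor 𝒜 a)
        (radicalSes_shortExact.map_of_exact (shiftFunctor 𝒜 b))
    rw [hx]
    exact ShortComplex.ShortExact.extClass_naturality
      ((radicalSes_shortExact.map_of_exact (shiftFunctor 𝒜 b)).map_of_exact (shiftFunctor 𝒜 a))
      (radicalSes_shortExact.map_of_exact (shiftFunctor 𝒜 (a + b))) τ
  simp only [Abelian.Ext.mapExactFunctor_comp, Abelian.Ext.mapExactFunctor_mk₀,
    radicalClass_mapExactFunctor, Abelian.Ext.comp_assoc_of_third_deg_zero,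
    Abelian.Ext.mk₀_comp_mk₀]
  rw [← Abelian.Ext.comp_assoc_of_third_deg_zero, ← hnat,
    Abelian.Ext.comp_assoc_of_third_deg_zero, Abelian.Ext.mk₀_comp_mk₀]
  rfl

/-- The right unit law compares a class with its shift by `0`. In degree one this again reduces to
the sequence `J → A → S`. -/
theorem yoneda_yonedaOne {W : GrMod 𝒜} (ξ : GExt (simpleTop 𝒜) W 1) :
    yoneda (zero_add 1) ξ (yonedaOne (simpleTop 𝒜)) = ξ := by
  induction ξ using DirectSum.induction_on with
  | zero => simp
  | add x y hx hy => rw [map_add, AddMonoidHom.add_apply, hx, hy]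
  | of b ξ =>
    rw [yonedaOne, yoneda_of, ← of_comp_shiftCast (zero_add b).symm ξ]
    congr 1
    obtain ⟨g, rfl⟩ := exists_radicalClass_comp ξ
    let τ : radicalSes 𝒜 ⟶ (radicalSes 𝒜).map (shiftFunctor 𝒜 0) :=
      { τ₁ := (radicalModule 𝒜).shiftZero
        τ₂ := (regular 𝒜).shiftZero
        τ₃ := (simpleTop 𝒜).shiftZero
        comm₁₂ := rfl
        comm₂₃ := rfl }
    have hnat : (radicalClass 𝒜).comp
        (Abelian.Ext.mk₀ (radicalModule 𝒜).shiftZero) (add_zero 1) =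
        (Abelian.Ext.mk₀ (simpleTop 𝒜).shiftZero).comp (shiftedRadicalClass 𝒜 0) (zero_add 1) :=
      ShortComplex.ShortExact.extClass_naturality radicalSes_shortExact
        (radicalSes_shortExact.map_of_exact (shiftFunctor 𝒜 0)) τ
    unfold yonedaHom
    simp only [Abelian.Ext.mapExactFunctor_comp, Abelian.Ext.mapExactFunctor_mk₀,
      radicalClass_mapExactFunctor, Abelian.Ext.comp_assoc_of_third_deg_zero,
      Abelian.Ext.mk₀_comp_mk₀]
    rw [← Abelian.Ext.comp_assoc_of_third_deg_zero, ← hnat,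
      Abelian.Ext.comp_assoc_of_third_deg_zero, Abelian.Ext.mk₀_comp_mk₀]
    rfl

/-! ### Generation of the Ext ring -/

/-- The products `Ext¹(S, S) ⋯ Ext¹(S, S)` with `n` factors, for `n ≥ 1`. -/
noncomputable def extPowers (S : GrMod 𝒜) : (n : ℕ) → AddSubgroup (GExt S S n)
  -- All of `Hom(S, S)` is taken in degree zero, so that the family is a graded subring of the kind
  -- tested by `ExtRingGeneratedByDegreeOne`.
  | 0 => ⊤
  | 1 => ⊤
  | n + 2 => AddSubgroup.closure {γ | ∃ (ξ : GExt S S 1) (α : GExt S S (n + 1)),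
      α ∈ extPowers S (n + 1) ∧ γ = yoneda rfl ξ α}

/-- A left factor from `Hom(S, S)` is absorbed by the first factor from `Ext¹(S, S)`. A longer left
factor is peeled one `Ext¹(S, S)` at a time, so `yoneda_assoc` is only used with leftmost degree `0`
or `1`. -/
theorem extPowers_mul_mem (j : ℕ) : ∀ (i n : ℕ) (h : i + j = n),
    ∀ β ∈ extPowers (simpleTop 𝒜) j, ∀ α ∈ extPowers (simpleTop 𝒜) i,
      yoneda h β α ∈ extPowers (simpleTop 𝒜) n := by
  induction j using Nat.strong_induction_on with
  | _ j ih =>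
  intro i n h β hβ α hα
  match j with
  | 0 =>
    obtain rfl : i = n := h
    match i with
    | 0 => trivial
    | 1 => trivial
    | i + 2 =>
      refine AddSubgroup.closure_induction
        (p := fun α _ => yoneda _ β α ∈ extPowers (simpleTop 𝒜) (i + 2)) ?_ ?_ ?_ ?_ hα
      · rintro _ ⟨ξ, α, hα, rfl⟩
        rw [← yoneda_assoc (fun _ => isShiftNatural_of_degree_zero) (add_zero 1) rfl]
        exact AddSubgroup.subset_closure ⟨_, α, hα, rfl⟩
      · rw [map_zero]; exact zero_mem _
      · intro x y _ _ hx hy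
        rw [map_add]; exact add_mem hx hy
      · intro x _ hx
        rw [map_neg]; exact neg_mem hx
  | 1 =>
    obtain rfl : i + 1 = n := h
    match i with
    | 0 => trivial
    | i + 1 => exact AddSubgroup.subset_closure ⟨β, α, hα, rfl⟩
  | j + 2 =>
    obtain rfl : n = i + j + 2 := by lia
    refine AddSubgroup.closure_induction
      (p := fun β _ => yoneda h β α ∈ extPowers (simpleTop 𝒜) (i + j + 2)) ?_ ?_ ?_ ?_ hβ
    · rintro _ ⟨ξ, β, hβ, rfl⟩
      have hmem := ih (j + 1) (by lia) i (i + j + 1) (by lia) β hβ α hα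
      have hassoc := yoneda_assoc (fun _ => radicalClass_isShiftNatural)
        (rfl : j + 1 + 1 = j + 2) h (by lia : i + (j + 1) = i + j + 1) rfl ξ β α
      exact AddSubgroup.subset_closure ⟨ξ, _, hmem, hassoc⟩
    · rw [map_zero]; exact zero_mem _
    · intro x y _ _ hx hy
      rw [map_add, AddMonoidHom.add_apply]; exact add_mem hx hy
    · intro x _ hx
      rw [map_neg, AddMonoidHom.neg_apply]; exact neg_mem hx

variable (𝒜) in
theorem extRingGeneratedByDegreeOne_iff :
    ExtRingGeneratedByDegreeOne (simpleTop 𝒜) ↔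
      ∀ n : ℕ, yonedaSpan (simpleTop 𝒜) (simpleTop 𝒜) (simpleTop 𝒜) 1 n (n + 1) rfl = ⊤ := by
  constructor
  · intro h n
    match n with
    -- The subring `extPowers` is everything in degree one by definition and says nothing here; the
    -- unit gives `Ext¹ · Hom = Ext¹`.
    | 0 =>
      refine eq_top_iff.2 fun ξ _ => ?_
      rw [← yoneda_yonedaOne ξ]
      exact AddSubgroup.subset_closure ⟨_, _, rfl⟩
    | n + 1 =>
      have := h (extPowers (simpleTop 𝒜)) rfl rfl
        (fun i j n h β hβ α hα => extPowers_mul_mem j i n h β hβ α hα) (n + 2)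
      rw [eq_top_iff, ← this]
      refine AddSubgroup.closure_mono ?_
      rintro _ ⟨ξ, α, -, rfl⟩
      exact ⟨ξ, α, rfl⟩
  · intro h T h0 h1 hT n
    induction n with
    | zero => exact h0
    | succ n ih =>
      rw [eq_top_iff, ← h n]
      refine (AddSubgroup.closure_le _).2 ?_
      rintro _ ⟨β, α, rfl⟩
      exact hT n 1 (n + 1) rfl β (by rw [h1]; trivial) α (by rw [ih]; trivial)

variable (𝒜) in
theorem yonedaSpan_eq_top_iff :
    (∀ i j : ℕ, yonedaSpan (simpleTop 𝒜) (simpleTop 𝒜) (simpleTop 𝒜) j i (i + j) rfl = ⊤) ↔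
      ∀ n : ℕ, yonedaSpan (simpleTop 𝒜) (simpleTop 𝒜) (simpleTop 𝒜) 1 n (n + 1) rfl = ⊤ := by
  refine ⟨fun h n => h n 1, fun h i j => ?_⟩
  induction j with
  | zero =>
    refine eq_top_iff.2 fun α _ => ?_
    rw [← yonedaOne_yoneda α]
    exact AddSubgroup.subset_closure ⟨_, _, rfl⟩
  | succ j ih =>
    -- `Extⁱ⁺ʲ⁺¹` is spanned by products `ξ · γ` with `ξ` in `Ext¹`. By induction `γ` is a sum of
    -- products `β · α`, and `ξ · (β · α) = (ξ · β) · α`.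
    rw [eq_top_iff, ← h (i + j)]
    refine (AddSubgroup.closure_le _).2 ?_
    rintro _ ⟨ξ, γ, rfl⟩
    have hγ : γ ∈ yonedaSpan (simpleTop 𝒜) (simpleTop 𝒜) (simpleTop 𝒜) j i (i + j) rfl := by
      rw [ih]; trivial
    refine AddSubgroup.closure_induction
      (p := fun γ _ => yoneda _ ξ γ ∈ yonedaSpan _ _ _ (j + 1) i (i + (j + 1)) rfl)
      ?_ ?_ ?_ ?_ hγ
    · rintro _ ⟨β, α, rfl⟩
      rw [← yoneda_assoc (fun _ => radicalClass_isShiftNatural) (rfl : j + 1 = j + 1) rfl]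
      exact AddSubgroup.subset_closure ⟨_, α, rfl⟩
    · rw [map_zero]; exact zero_mem _
    · intro x y _ _ hx hy
      rw [map_add]; exact add_mem hx hy
    · intro x _ hx
      rw [map_neg]; exact neg_mem hx

/-! ### Finiteness of `S` and the conclusion -/

theorem simpleTop_isLeftFinite (hfin : IsLeftFiniteRing 𝒜) : (simpleTop 𝒜).IsLeftFinite := by
  intro k
  rw [← component_fg_iff]
  let R := SetLike.GradeZero.subring 𝒜
  let q : (regular 𝒜) →ₗ[R] (simpleTop 𝒜) := (lin (simpleTopπ 𝒜)).restrictScalars R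
  exact (regular_component_fg hfin k).map q

theorem simpleTop_isBoundedBelow : (simpleTop 𝒜).IsBoundedBelow := by
  refine ⟨0, fun k hk => (AddSubgroup.eq_bot_iff_forall _).2 ?_⟩
  rintro _ ⟨(a : A), ha, rfl⟩
  have h0 : a = 0 := intGrading_eq_zero (𝒜 := 𝒜) hk ha
  rw [h0]
  exact map_zero _

end SimpleTop

end GrMod

theorem theorem3 {A : Type u} [Ring A] (𝒜 : ℕ → AddSubgroup A) [GradedRing 𝒜]
    (hfin : IsLeftFiniteRing 𝒜) (hgen : IsGeneratedInDegreeOne 𝒜)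
    (hnoeth : IsNoetherianRing (𝒜 0)) (hsemi : IsSemiperfectRing (𝒜 0)) :
    (∀ M : GrMod 𝒜, M.IsLeftFinite → M.IsBoundedBelow →
      (M.IsQuasiKoszul ↔
        ∀ n : ℕ, GrMod.yonedaSpan M (GrMod.simpleTop 𝒜) (GrMod.simpleTop 𝒜) 1 n (n + 1) rfl = ⊤)) ∧
    ((GrMod.simpleTop 𝒜).IsQuasiKoszul ↔
      GrMod.ExtRingGeneratedByDegreeOne (GrMod.simpleTop 𝒜)) ∧
    ((GrMod.simpleTop 𝒜).IsQuasiKoszul ↔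
      ∀ i j : ℕ, GrMod.yonedaSpan (GrMod.simpleTop 𝒜) (GrMod.simpleTop 𝒜) (GrMod.simpleTop 𝒜)
        j i (i + j) rfl = ⊤) := by
  have hS := GrMod.isQuasiKoszul_iff hfin hnoeth hsemi (GrMod.simpleTop_isLeftFinite hfin)
    GrMod.simpleTop_isBoundedBelow
  exact ⟨fun M hM hb => GrMod.isQuasiKoszul_iff hfin hnoeth hsemi hM hb,
    hS.trans (GrMod.extRingGeneratedByDegreeOne_iff 𝒜).symm,
    hS.trans (GrMod.yonedaSpan_eq_top_iff 𝒜).symm⟩
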